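/- Let $E/K$ be a Galois extension of number fields with group $G$, let $K'$ be an intermediate field, $G_{K'}\subset G$ the subgroup fixing $K'$, and $\Omega=G/G_{K'}$. Let $T'=\mathrm{Res}_{K'/K}(\mathbb{G}_m)$ be the Weil restriction, the commutative affine group scheme over $K$ with $T'(R)=(K'\otimes_K R)^\times$ for every commutative $K$-algebra $R$. For a commutative affine group scheme $T$ over $K$ let $X(T)=\mathrm{Hom}(T_E,\mathbb{G}_{m,E})$ be its group of characters over $E$, with its natural action of $G$. (a) The map $\mathbb{Z}\to X(\mathbb{G}_m)$, $n\mapsto(x\mapsto x^n)$, and the map $\mathbb{Z}\Omega\to X(T')$ sending a coset $gG_{K'}$ to the character $(K'\otimes_K R)^\times\to R^\times$, $a\otimes r\mapsto g(a)r$ ($R$ an $E$-algebra), are isomorphisms of $G$-modules. Likewise the canonical ring homomorphism $K'\otimes_K\mathbb{A}_K\to\mathbb{A}_{K'}$ is an isomorphism, and so identifies $T'(\mathbb{A}_K)$ with the idele group $\mathbb{I}_{K'}=\mathbb{A}_{K'}^\times$. (b) Let $\iota:\mathbb{Z}\to\mathbb{Z}\Omega$ be the homomorphism of $G$-modules with $\iota(1)=\sum_{\omega\in\Omega}\omega$.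 There is exactly one morphism $N:T'\to\mathbb{G}_m$ of group schemes over $K$ that corresponds to $\iota$, i.e. such that $X(N):X(\mathbb{G}_m)\to X(T')$, $\chi\mapsto\chi\circ N$, becomes $\iota$ under the identifications in (a). (c) For this $N$, the homomorphism $N(\mathbb{A}_K):\mathbb{I}_{K'}=T'(\mathbb{A}_K)\to\mathbb{G}_m(\mathbb{A}_K)=\mathbb{I}_K$ is the idele norm, that is, for every $y\in\mathbb{I}_{K'}$ and every place $v$ of $K$, $$\bigl(N(\mathbb{A}_K)(y)\bigr)_v=\prod_{w\mid v}N_{K'_w/K_v}(y_w),$$ where $w$ runs over the places of $K'$ above $v$. -/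

import Mathlib

open CategoryTheory NumberField IsDedekindDomain
open scoped TensorProduct

universe u

namespace QuasiSplitTorus

/-- Restriction of scalars along a ring homomorphism, as a functor between categories of
commutative algebras. -/
def restrict {A B : Type u} [CommRing A] [CommRing B] (f : A →+* B) :
    CommAlgCat.{u} B ⥤ CommAlgCat.{u} A where
  obj R := @CommAlgCat.of A _ R _ (Algebra.compHom R f)
  map {R S} φ :=
    letI : Algebra A R := Algebra.compHom R f
    letI : Algebra A S := Algebra.compHom S f
    CommAlgCat.ofHom { φ.hom.toRingHom with commutes' := fun a => φ.hom.commutes (f a) }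

/-- Extension of scalars `R ↦ L ⊗[K] R`. -/
def extend (K L : Type u) [CommRing K] [CommRing L] [Algebra K L] :
    CommAlgCat.{u} K ⥤ CommAlgCat.{u} L where
  obj R := CommAlgCat.of L (L ⊗[K] R)
  map φ := CommAlgCat.ofHom (Algebra.TensorProduct.map (AlgHom.id L L) φ.hom)
  map_id R := by
    ext x
    simp
  map_comp φ ψ := by
    apply CommAlgCat.hom_ext
    apply Algebra.TensorProduct.ext
    · ext
    · ext
      simp

/-- The functor of points of the multiplicative group, `R ↦ Rˣ`. -/
def gmPoints (K : Type u) [CommRing K] : CommAlgCat.{u} K ⥤ CommGrpCat.{u} where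
  obj R := CommGrpCat.of Rˣ
  map φ := CommGrpCat.ofHom (Units.map (φ.hom : _ →* _))

/-- The functor of points of the Weil restriction of the multiplicative group,
`R ↦ (L ⊗[K] R)ˣ`. -/
def weilPoints (K L : Type u) [CommRing K] [CommRing L] [Algebra K L] :
    CommAlgCat.{u} K ⥤ CommGrpCat.{u} := extend K L ⋙ gmPoints L

/-- A functor whose values are the solution sets of polynomial equations is representable. -/
theorem corep_of_equations {K : Type u} [CommRing K] (F : CommAlgCat.{u} K ⥤ Type u)
    {σ : Type u} (S : Set (MvPolynomial σ K))
    (e : ∀ R : CommAlgCat.{u} K,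
      F.obj R ≃ {x : σ → R // ∀ p ∈ S, MvPolynomial.aeval x p = 0})
    (he : ∀ {R R' : CommAlgCat.{u} K} (φ : R ⟶ R') (x : F.obj R) (i : σ),
      (e R' (F.map φ x)).1 i = φ.hom ((e R x).1 i)) : F.IsCorepresentable := by
  let A := MvPolynomial σ K ⧸ Ideal.span S
  let h : ∀ R : CommAlgCat.{u} K, (A →ₐ[K] R) ≃
      {x : σ → R // ∀ p ∈ S, MvPolynomial.aeval x p = 0} := fun R =>
    { toFun := fun f => ⟨fun i => f (Ideal.Quotient.mk _ (MvPolynomial.X i)), fun p hp => by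
        have : MvPolynomial.aeval (fun i => f (Ideal.Quotient.mk _ (MvPolynomial.X i))) =
            f.comp (Ideal.Quotient.mkₐ K (Ideal.span S)) := by
          ext i
          simp
          rfl
        rw [this, AlgHom.comp_apply, Ideal.Quotient.mkₐ_eq_mk,
          Ideal.Quotient.eq_zero_iff_mem.mpr (Ideal.subset_span hp), map_zero]⟩
      invFun := fun x => Ideal.Quotient.liftₐ _ (MvPolynomial.aeval x.1) (fun p hp => by
        have : Ideal.span S ≤ RingHom.ker (MvPolynomial.aeval x.1 : _ →ₐ[K] R) :=
          Ideal.span_le.mpr fun q hq => x.2 q hq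
        exact this hp)
      left_inv := fun f => by
        apply Ideal.Quotient.algHom_ext
        ext i
        exact MvPolynomial.aeval_X _ i
      right_inv := fun x => by
        ext i
        exact MvPolynomial.aeval_X _ i }
  exact ⟨CommAlgCat.of K A, ⟨
    { homEquiv := fun {R} =>
        ((⟨fun f => f.hom, fun f => CommAlgCat.ofHom f, fun _ => rfl, fun _ => rfl⟩ :
          (CommAlgCat.of K A ⟶ R) ≃ (A →ₐ[K] R)).trans (h R)).trans (e R).symm
      homEquiv_comp := fun {R R'} g f => by
        simp only [Equiv.trans_apply, Equiv.coe_fn_mk]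
        rw [Equiv.symm_apply_eq]
        ext i
        rw [he]
        simp [h] }⟩⟩

theorem gmPoints_corep (K : Type u) [CommRing K] :
    (gmPoints K ⋙ forget CommGrpCat).IsCorepresentable := by
  refine corep_of_equations _ (σ := ULift.{u} Bool)
    {MvPolynomial.X ⟨true⟩ * MvPolynomial.X ⟨false⟩ - 1} (fun R =>
    { toFun := fun (x : Rˣ) => ⟨fun i => if i.down then x.1 else x⁻¹.1, by simp⟩
      invFun := fun x => (⟨x.1 ⟨true⟩, x.1 ⟨false⟩,
        by simpa [sub_eq_zero] using x.2,
        by simpa [sub_eq_zero, mul_comm] using x.2⟩ : Rˣ)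
      left_inv := fun x => Units.ext rfl
      right_inv := fun x => by
        ext ⟨_ | _⟩ <;> rfl }) ?_
  rintro R R' φ x ⟨_ | _⟩ <;> rfl

theorem weilPoints_corep (K L : Type u) [Field K] [Field L] [Algebra K L]
    [FiniteDimensional K L] :
    (weilPoints K L ⋙ forget CommGrpCat).IsCorepresentable := by
  classical
  let ι := Module.Free.ChooseBasisIndex K L
  let b : Module.Basis ι K L := Module.Free.chooseBasis K L
  -- coordinates on `L ⊗[K] R`
  let c : ∀ R : CommAlgCat.{u} K, (L ⊗[K] R) ≃ₗ[K] (ι → R) := fun R =>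
    (TensorProduct.equivFinsuppOfBasisLeft b).trans (Finsupp.linearEquivFunOnFinite K R ι)
  have hc : ∀ (R : CommAlgCat.{u} K) (l : L) (r : R) (k : ι),
      c R (l ⊗ₜ r) k = b.repr l k • r := fun R l r k => by
    simp [c]
  have hc' : ∀ (R : CommAlgCat.{u} K) (x : ι → R), (c R).symm x = ∑ i, b i ⊗ₜ[K] x i := by
    intro R x
    rw [LinearEquiv.symm_apply_eq]
    ext k
    simp [hc, Finsupp.single_apply]
  let p : ι → MvPolynomial (ι ⊕ ι) K := fun k =>
    ∑ i, ∑ j, b.repr (b i * b j) k • (MvPolynomial.X (Sum.inl i) * MvPolynomial.X (Sum.inr j))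
      - MvPolynomial.C (b.repr 1 k)
  have key : ∀ (R : CommAlgCat.{u} K) (x : ι ⊕ ι → R),
      (∀ q ∈ Set.range p, MvPolynomial.aeval x q = 0) ↔
      (c R).symm (x ∘ Sum.inl) * (c R).symm (x ∘ Sum.inr) = 1 := by
    intro R x
    rw [← (c R).injective.eq_iff, funext_iff, Set.forall_mem_range]
    refine forall_congr' fun k => ?_
    rw [hc', hc', Algebra.TensorProduct.one_def, hc, Finset.sum_mul_sum]
    simp only [map_sum, Finset.sum_apply, Algebra.TensorProduct.tmul_mul_tmul, hc, p, map_sub,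
      map_smul, map_mul, MvPolynomial.aeval_X, MvPolynomial.aeval_C, sub_eq_zero,
      Function.comp_apply, Algebra.algebraMap_eq_smul_one]
  refine corep_of_equations _ (σ := ι ⊕ ι) (Set.range p) (fun R =>
    { toFun := fun (x : (L ⊗[K] R)ˣ) => ⟨Sum.elim (c R x.1) (c R x⁻¹.1), by
        rw [key]
        simp⟩
      invFun := fun x => (⟨(c R).symm (x.1 ∘ Sum.inl), (c R).symm (x.1 ∘ Sum.inr),
        (key R x.1).mp x.2, by rw [mul_comm]; exact (key R x.1).mp x.2⟩ : (L ⊗[K] R)ˣ)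
      left_inv := fun x => Units.ext (by simp)
      right_inv := fun x => by
        ext (i | i)
        · simp
        · simp [Units.inv_mk] }) ?_
  intro R R' φ x i
  have hφ : ∀ z : L ⊗[K] R, ∀ k, c R' (Algebra.TensorProduct.map (AlgHom.id L L) φ.hom z) k =
      φ.hom (c R z k) := by
    intro z k
    induction z with
    | zero => simp
    | tmul l r => simp [hc]
    | add z w hz hw => simp [hz, hw]
  rcases i with i | i
  · exact hφ _ _
  · exact hφ _ _


/-- A commutative affine group scheme over `K`, given by its functor of points: a representable
functor from commutative `K`-algebras to commutative groups. -/
structure AffineGroupScheme (K : Type u) [CommRing K] where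
  points : CommAlgCat.{u} K ⥤ CommGrpCat.{u}
  corepresentable : (points ⋙ forget CommGrpCat).IsCorepresentable

/-- A morphism of group schemes over `K` is, by Yoneda, a natural family of group homomorphisms
`G(R) → H(R)`. -/
abbrev AffineGroupScheme.Hom {K : Type u} [CommRing K] (G H : AffineGroupScheme K) :=
  G.points ⟶ H.points

/-- The group homomorphism `G(R) → H(R)` induced on `R`-valued points. -/
def AffineGroupScheme.Hom.onPoints {K : Type u} [CommRing K] {G H : AffineGroupScheme K}
    (N : G.Hom H) (R : Type u) [CommRing R] [Algebra K R] :
    G.points.obj (CommAlgCat.of K R) →* H.points.obj (CommAlgCat.of K R) :=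
  (N.app (CommAlgCat.of K R)).hom

/-- The multiplicative group. -/
def Gm (K : Type u) [CommRing K] : AffineGroupScheme K := ⟨gmPoints K, gmPoints_corep K⟩

/-- The Weil restriction `Res_{L/K} G_m`, with `R`-points `(L ⊗[K] R)ˣ`. -/
def ResGm (K L : Type u) [Field K] [Field L] [Algebra K L] [FiniteDimensional K L] :
    AffineGroupScheme K := ⟨weilPoints K L, weilPoints_corep K L⟩

section Characters

variable {K : Type u} (E : Type u) [Field K] [Field E] [Algebra K E]

/-- The characters of `T` defined over `E`: the homomorphisms `T_E → G_m` of group schemes over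
`E`. -/
def CharGroup (T : AffineGroupScheme K) :=
  restrict (algebraMap K E) ⋙ T.points ⟶ (Gm E).points

variable {E} {T : AffineGroupScheme K}

namespace CharGroup

/-- The value of a character on an `R`-point of `T`. -/
def eval (χ : CharGroup E T) (R : CommAlgCat.{u} E)
    (x : T.points.obj ((restrict (algebraMap K E)).obj R)) : Rˣ :=
  (NatTrans.app χ R).hom x

theorem ext {χ ψ : CharGroup E T} (h : ∀ R x, χ.eval R x = ψ.eval R x) : χ = ψ := by
  apply NatTrans.ext
  funext R
  ext x
  exact h R x

/-- Build a character from its values. -/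
def ofValues (f : ∀ R : CommAlgCat.{u} E, T.points.obj ((restrict (algebraMap K E)).obj R) →* Rˣ)
    (hf : ∀ {R S : CommAlgCat.{u} E} (φ : R ⟶ S)
      (x : T.points.obj ((restrict (algebraMap K E)).obj R)),
      f S ((T.points.map ((restrict (algebraMap K E)).map φ)).hom x) =
        Units.map (φ.hom : _ →* _) (f R x)) : CharGroup E T where
  app R := CommGrpCat.ofHom (f R)
  naturality R S φ := by
    apply CommGrpCat.hom_ext
    apply MonoidHom.ext
    intro x
    exact hf φ x

theorem eval_natural (χ : CharGroup E T) {R S : CommAlgCat.{u} E} (φ : R ⟶ S)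
    (x : T.points.obj ((restrict (algebraMap K E)).obj R)) :
    χ.eval S ((T.points.map ((restrict (algebraMap K E)).map φ)).hom x) =
      Units.map (φ.hom : _ →* _) (χ.eval R x) :=
  congrArg (fun f => f.hom x) (NatTrans.naturality χ φ)

theorem eval_mul (χ : CharGroup E T) (R : CommAlgCat.{u} E)
    (x y : T.points.obj ((restrict (algebraMap K E)).obj R)) :
    χ.eval R (x * y) = χ.eval R x * χ.eval R y :=
  map_mul (NatTrans.app χ R).hom x y

theorem eval_one (χ : CharGroup E T) (R : CommAlgCat.{u} E) : χ.eval R 1 = 1 :=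
  map_one (NatTrans.app χ R).hom

instance : Mul (CharGroup E T) where
  mul χ ψ := ofValues (fun R =>
    { toFun := fun x => χ.eval R x * ψ.eval R x
      map_one' := by rw [eval_one, eval_one, mul_one]
      map_mul' := fun x y => by rw [eval_mul, eval_mul, mul_mul_mul_comm] }) (fun φ x => by
    simp only [MonoidHom.coe_mk, OneHom.coe_mk, eval_natural, map_mul])

instance : One (CharGroup E T) where
  one := ofValues (fun _ => 1) (fun φ x => by simp)

instance : Inv (CharGroup E T) where
  inv χ := ofValues (fun R =>
    { toFun := fun x => (χ.eval R x)⁻¹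
      map_one' := by rw [eval_one, inv_one]
      map_mul' := fun x y => by rw [eval_mul, mul_inv] }) (fun φ x => by
    simp only [MonoidHom.coe_mk, OneHom.coe_mk, eval_natural, map_inv])

theorem mul_eval (χ ψ : CharGroup E T) (R : CommAlgCat.{u} E)
    (x : T.points.obj ((restrict (algebraMap K E)).obj R)) :
    (χ * ψ).eval R x = χ.eval R x * ψ.eval R x := rfl

theorem one_eval (R : CommAlgCat.{u} E)
    (x : T.points.obj ((restrict (algebraMap K E)).obj R)) :
    (1 : CharGroup E T).eval R x = 1 := rfl

theorem inv_eval (χ : CharGroup E T) (R : CommAlgCat.{u} E)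
    (x : T.points.obj ((restrict (algebraMap K E)).obj R)) :
    (χ⁻¹).eval R x = (χ.eval R x)⁻¹ := rfl

/-- Characters form a commutative group under pointwise multiplication. -/
instance : CommGroup (CharGroup E T) where
  mul_assoc χ ψ θ := ext fun R x => by simp only [mul_eval, mul_assoc]
  one_mul χ := ext fun R x => by rw [mul_eval, one_eval, one_mul]
  mul_one χ := ext fun R x => by rw [mul_eval, one_eval, mul_one]
  inv_mul_cancel χ := ext fun R x => by rw [mul_eval, inv_eval, one_eval, inv_mul_cancel]
  mul_comm χ ψ := ext fun R x => by rw [mul_eval, mul_eval, mul_comm]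

end CharGroup

/-- For `σ ∈ Gal(E/K)`, the identity of `R` as an isomorphism of `K`-algebras between `R` and its
twist by `σ` (the same ring, on which `E` acts through `σ`). -/
def twistId (σ : Gal(E/K)) (R : CommAlgCat.{u} E) :
    (restrict (algebraMap K E)).obj R ⟶
      (restrict (algebraMap K E)).obj ((restrict (σ : E →+* E)).obj R) :=
  letI : Algebra K R := Algebra.compHom R (algebraMap K E)
  letI : Algebra K ((restrict (σ : E →+* E)).obj R) :=
    Algebra.compHom ((restrict (σ : E →+* E)).obj R) (algebraMap K E)
  CommAlgCat.ofHom
    { RingHom.id R with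
      commutes' := fun a => congrArg (algebraMap E R) (σ.commutes a).symm }

namespace CharGroup

/-- The Galois action on characters: `(σ • χ)` is evaluated on an `R`-point by letting `E` act on
`R` through `σ`. -/
instance : SMul Gal(E/K) (CharGroup E T) where
  smul σ χ := ofValues (fun R =>
    { toFun := fun x => (χ.eval ((restrict (σ : E →+* E)).obj R)
        ((T.points.map (twistId σ R)).hom x) : Rˣ)
      map_one' := by rw [map_one]; exact eval_one χ _
      map_mul' := fun x y => by rw [map_mul]; exact eval_mul χ _ _ _ }) (fun {R S} φ x => by
    have h : (restrict (algebraMap K E)).map φ ≫ twistId σ S =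
      twistId σ R ≫ (restrict (algebraMap K E)).map ((restrict (σ : E →+* E)).map φ) := rfl
    have h2 := congrArg (fun f => (T.points.map f).hom x) h
    simp only [Functor.map_comp] at h2
    have h3 := eval_natural χ ((restrict (σ : E →+* E)).map φ)
      ((T.points.map (twistId σ R)).hom x)
    exact (congrArg (χ.eval _) h2).trans h3)

theorem smul_eval (σ : Gal(E/K)) (χ : CharGroup E T) (R : CommAlgCat.{u} E)
    (x : T.points.obj ((restrict (algebraMap K E)).obj R)) :
    (σ • χ).eval R x =
      χ.eval ((restrict (σ : E →+* E)).obj R) ((T.points.map (twistId σ R)).hom x) := rfl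

instance : MulDistribMulAction Gal(E/K) (CharGroup E T) where
  one_smul χ := ext fun R x => by
    let φ : R ⟶ (restrict ((1 : Gal(E/K)) : E →+* E)).obj R :=
      letI : Algebra E R := Algebra.compHom R ((1 : Gal(E/K)) : E →+* E)
      @CommAlgCat.ofHom E _ R R _ _ _ (Algebra.compHom R ((1 : Gal(E/K)) : E →+* E))
        { RingHom.id R with commutes' := fun a => rfl }
    exact (eval_natural χ φ x).trans (Units.ext rfl)
  mul_smul σ τ χ := ext fun R x => by
    let φ : (restrict ((σ * τ : Gal(E/K)) : E →+* E)).obj R ⟶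
        (restrict (τ : E →+* E)).obj ((restrict (σ : E →+* E)).obj R) :=
      letI i1 : Algebra E R := Algebra.compHom R ((σ * τ : Gal(E/K)) : E →+* E)
      letI i2 : Algebra E ((restrict (σ : E →+* E)).obj R) :=
        Algebra.compHom ((restrict (σ : E →+* E)).obj R) (τ : E →+* E)
      @CommAlgCat.ofHom E _ R ((restrict (σ : E →+* E)).obj R) _ i1 _ i2
        { RingHom.id R with commutes' := fun a => rfl }
    have h := eval_natural χ φ ((T.points.map (twistId (σ * τ) R)).hom x)
    have h1 : twistId (σ * τ) R ≫ (restrict (algebraMap K E)).map φ =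
      twistId σ R ≫ twistId τ _ := rfl
    have h2 := congrArg (fun f => (T.points.map f).hom x) h1
    simp only [Functor.map_comp] at h2
    refine (Units.ext rfl : _ = _).trans (h.symm.trans (congrArg (χ.eval _) h2))
  smul_mul σ χ ψ := ext fun R x => by simp only [smul_eval, mul_eval]; rfl
  smul_one σ := ext fun R x => rfl

end CharGroup

/-- The character group `X(T)` as a `Gal(E/K)`-module. -/
noncomputable abbrev charModule (E : Type u) [Field E] [Algebra K E] (T : AffineGroupScheme K) :
    Representation ℤ Gal(E/K) (Additive (CharGroup E T)) :=
  Representation.ofMulDistribMulAction Gal(E/K) (CharGroup E T)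

/-- Contravariant functoriality of the character group: `X(N) : X(T') → X(T)`, `χ ↦ χ ∘ N`. -/
def CharGroup.pullback {T' : AffineGroupScheme K} (N : T.Hom T') (χ : CharGroup E T') :
    CharGroup E T :=
  Functor.whiskerLeft (restrict (algebraMap K E)) N ≫ χ

/-- The tautological character of `G_m`. -/
def idChar (K E : Type u) [Field K] [Field E] [Algebra K E] : CharGroup E (Gm K) :=
  CharGroup.ofValues (fun R => MonoidHom.id Rˣ) (fun _ _ => rfl)

theorem smul_idChar (σ : Gal(E/K)) : σ • idChar K E = idChar K E := rfl

/-- The identification of the trivial module `ℤ` with `X(G_m)`: `n` goes to `x ↦ x ^ n`. -/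
noncomputable def gmCharMap (K E : Type u) [Field K] [Field E] [Algebra K E] :
    (Representation.trivial ℤ Gal(E/K) ℤ).IntertwiningMap (charModule E (Gm K)) where
  toLinearMap := LinearMap.toSpanSingleton ℤ _ (Additive.ofMul (idChar K E))
  isIntertwining' σ := by
    ext
    simp [smul_idChar]

variable {L : Type u} [Field L] [Algebra K L]

/-- For a homomorphism `a : L → A` of `K`-algebras, the homomorphism `L ⊗[K] A → A`,
`l ⊗ r ↦ a(l) r`. -/
noncomputable def tensorEval {A : Type u} [CommRing A] [Algebra K A] (a : L →ₐ[K] A) :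
    L ⊗[K] A →ₐ[K] A :=
  Algebra.TensorProduct.lift a (AlgHom.id K A) fun _ _ => Commute.all _ _

theorem tensorEval_map {A B : Type u} [CommRing A] [Algebra K A] [CommRing B] [Algebra K B]
    (a : L →ₐ[K] A) (b : L →ₐ[K] B) (f : A →ₐ[K] B) (h : ∀ l, f (a l) = b l) (z : L ⊗[K] A) :
    tensorEval b (Algebra.TensorProduct.map (AlgHom.id L L) f z) = f (tensorEval a z) := by
  induction z with
  | zero => simp only [map_zero]
  | add z w hz hw => simp only [map_add, hz, hw]
  | tmul l r => simp [tensorEval, h]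

/-- The composite `L → E → R` of an embedding and the structure map of an `E`-algebra. -/
def embPoint (φ : L →ₐ[K] E) (R : CommAlgCat.{u} E) :
    L →ₐ[K] (restrict (algebraMap K E)).obj R :=
  { (algebraMap E R).comp φ.toRingHom with
    commutes' := fun x => congrArg (algebraMap E R) (φ.commutes x) }

variable [FiniteDimensional K L]

/-- The character of `Res_{L/K} G_m` attached to an embedding `φ : L → E` over `K`; on `R`-points
it is `(L ⊗[K] R)ˣ → Rˣ`, `l ⊗ r ↦ φ(l) r`. -/
noncomputable def embChar (φ : L →ₐ[K] E) : CharGroup E (ResGm K L) :=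
  CharGroup.ofValues (fun R => Units.map ((tensorEval (embPoint φ R)).toRingHom.toMonoidHom :
    L ⊗[K] ((restrict (algebraMap K E)).obj R) →* (restrict (algebraMap K E)).obj R))
    (fun {R S} f x =>
    Units.ext (tensorEval_map (embPoint φ R) (embPoint φ S)
      ((restrict (algebraMap K E)).map f).hom (fun l => f.hom.commutes (φ l)) x.1))

theorem smul_embChar (σ : Gal(E/K)) (φ : L →ₐ[K] E) :
    σ • embChar φ = embChar ((σ : E →ₐ[K] E).comp φ) :=
  CharGroup.ext fun R x => Units.ext
    (tensorEval_map (embPoint ((σ : E →ₐ[K] E).comp φ) R)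
      (embPoint φ ((restrict (σ : E →+* E)).obj R)) (twistId σ R).hom (fun _ => rfl) x.1)

end Characters

section Correspondence

variable {K E : Type u} [Field K] [Field E] [Algebra K E]

/-- The embedding `K' → E` attached to a coset `g G_{K'}`, namely the restriction of `g`. -/
def cosetEmb (K' : IntermediateField K E) (ω : Gal(E/K) ⧸ K'.fixingSubgroup) : K' →ₐ[K] E :=
  Quotient.liftOn' ω (fun g => (g : E →ₐ[K] E).comp K'.val) (fun g h hgh => by
    rw [QuotientGroup.leftRel_apply, IntermediateField.mem_fixingSubgroup_iff] at hgh
    ext x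
    have := congrArg g (hgh x x.2)
    simpa using this.symm)

theorem cosetEmb_smul (K' : IntermediateField K E) (σ : Gal(E/K))
    (ω : Gal(E/K) ⧸ K'.fixingSubgroup) :
    cosetEmb K' (σ • ω) = (σ : E →ₐ[K] E).comp (cosetEmb K' ω) := by
  induction ω using Quotient.inductionOn' with
  | h g => rfl

variable [FiniteDimensional K E]

/-- The identification of `ℤ[G/G_{K'}]` with the character module of `Res_{K'/K} G_m`: a coset
`g G_{K'}` goes to the character attached to the embedding `g : K' → E`. -/
noncomputable def resCharMap (K' : IntermediateField K E) :
    (Representation.ofMulAction ℤ Gal(E/K) (Gal(E/K) ⧸ K'.fixingSubgroup)).IntertwiningMap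
      (charModule E (ResGm K K')) where
  toLinearMap := (Finsupp.linearCombination ℤ fun ω =>
    (Additive.ofMul (embChar (cosetEmb K' ω)) : Additive (CharGroup E (ResGm K K')))) ∘ₗ
      (MonoidAlgebra.coeffLinearEquiv ℤ).toLinearMap
  isIntertwining' σ := by
    ext ω
    simp [cosetEmb_smul, smul_embChar]

/-- The homomorphism `ℤ → ℤ[G/G_{K'}]` of `G`-modules sending `1` to the sum of the cosets. -/
noncomputable def sumCosets (K' : IntermediateField K E) :
    (Representation.trivial ℤ Gal(E/K) ℤ).IntertwiningMap
      (Representation.ofMulAction ℤ Gal(E/K) (Gal(E/K) ⧸ K'.fixingSubgroup)) where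
  toLinearMap := LinearMap.toSpanSingleton ℤ _
    (∑ᶠ ω : Gal(E/K) ⧸ K'.fixingSubgroup, MonoidAlgebra.single ω 1)
  isIntertwining' σ := by
    classical
    have := Fintype.ofFinite (Gal(E/K) ⧸ K'.fixingSubgroup)
    ext
    have h : ∑ ω : Gal(E/K) ⧸ K'.fixingSubgroup, MonoidAlgebra.single (σ • ω) (1 : ℤ) =
        ∑ ω : Gal(E/K) ⧸ K'.fixingSubgroup, MonoidAlgebra.single ω 1 :=
      Fintype.sum_equiv (MulAction.toPerm σ) _ _ fun _ => rfl
    simp [finsum_eq_sum_of_fintype, map_sum, h]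

/-- `N : Res_{K'/K} G_m → G_m` corresponds to the homomorphism of `G`-modules
`f : ℤ → ℤ[G/G_{K'}]` under the contravariant equivalence between tori and their character
modules: `X(N)` is `f`, after the identifications of `X(G_m)` with `ℤ` and of
`X(Res_{K'/K} G_m)` with `ℤ[G/G_{K'}]`. -/
def CorrespondsTo {K' : IntermediateField K E} (N : (ResGm K K').Hom (Gm K))
    (f : (Representation.trivial ℤ Gal(E/K) ℤ).IntertwiningMap
      (Representation.ofMulAction ℤ Gal(E/K) (Gal(E/K) ⧸ K'.fixingSubgroup))) : Prop :=
  ∀ n : ℤ, CharGroup.pullback N (gmCharMap K E n).toMul = (resCharMap K' (f n)).toMul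

end Correspondence

section Adeles

theorem comap_liesOver (K L : Type u) [Field K] [Field L] [Algebra K L] (w : InfinitePlace L) :
    w.LiesOver (w.comap (algebraMap K L)) :=
  ⟨rfl⟩

variable {K L : Type u} [Field K] [NumberField K] [Field L] [NumberField L] [Algebra K L]

/-- The continuous homomorphism `K_v → L_w` extending `K → L`, for `w` a prime over `v`. -/
noncomputable def finCompletionMap (v : HeightOneSpectrum (𝓞 K)) (w : HeightOneSpectrum (𝓞 L))
    [w.asIdeal.LiesOver v.asIdeal] : v.adicCompletion K →+* w.adicCompletion L :=
  ((HeightOneSpectrum.adicCompletion.equiv L w).symm.toRingHom.comp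
    (UniformSpace.Completion.mapRingHom
      (algebraMap (WithVal (v.valuation K)) (WithVal (w.valuation L)))
      (v.uniformContinuous_algebraMap_liesOver K L w).continuous)).comp
    (HeightOneSpectrum.adicCompletion.equiv K v).toRingHom

section

variable (v : HeightOneSpectrum (𝓞 K)) (w : HeightOneSpectrum (𝓞 L))
  [w.asIdeal.LiesOver v.asIdeal]

theorem continuous_finCompletionMap : Continuous (finCompletionMap v w) :=
  (HeightOneSpectrum.adicCompletion.continuous_ofCompletion L w).comp <|
    UniformSpace.Completion.continuous_map.comp
      (HeightOneSpectrum.adicCompletion.continuous_toCompletion K v)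

theorem finCompletionMap_coe (x : K) :
    finCompletionMap v w (x : v.adicCompletion K) = (algebraMap K L x : L) := by
  apply HeightOneSpectrum.adicCompletion.ext
  refine (UniformSpace.Completion.mapRingHom_coe
    (v.uniformContinuous_algebraMap_liesOver K L w).continuous _).trans ?_
  rfl

theorem finCompletionMap_mem {x : v.adicCompletion K} (hx : x ∈ v.adicCompletionIntegers K) :
    finCompletionMap v w x ∈ w.adicCompletionIntegers L := by
  have hopen : IsOpen (v.adicCompletionIntegers K : Set (v.adicCompletion K)) :=
    Valued.isOpen_valuationSubring _
  have hclosed : IsClosed (w.adicCompletionIntegers L : Set (w.adicCompletion L)) :=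
    Valued.isClosed_valuationSubring _
  have h : ∀ y : v.adicCompletion K, y ∈ (v.adicCompletionIntegers K : Set (v.adicCompletion K))ᶜ ∪
      finCompletionMap v w ⁻¹' (w.adicCompletionIntegers L : Set (w.adicCompletion L)) := by
    intro y
    refine (v.denseRange_algebraMap K).induction_on
      (p := fun y => y ∈ (v.adicCompletionIntegers K : Set (v.adicCompletion K))ᶜ ∪
        finCompletionMap v w ⁻¹' (w.adicCompletionIntegers L : Set (w.adicCompletion L))) y
      (hopen.isClosed_compl.union (hclosed.preimage (continuous_finCompletionMap v w))) ?_
    intro k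
    by_cases hk : v.valuation K k ≤ 1
    · right
      change finCompletionMap v w (k : v.adicCompletion K) ∈ w.adicCompletionIntegers L
      rw [finCompletionMap_coe, HeightOneSpectrum.mem_adicCompletionIntegers,
        HeightOneSpectrum.valuedAdicCompletion_eq_valuation', ← v.valuation_liesOver L w]
      exact pow_le_one' hk _
    · left
      intro hk'
      refine hk ?_
      rw [← HeightOneSpectrum.valuedAdicCompletion_eq_valuation']
      exact hk'
  rcases h x with h | h
  · exact absurd hx h
  · exact h

/-- The local norm `L_w → K_v` at a prime `w` of `L` over `v`. -/
noncomputable def finLocalNorm : w.adicCompletion L →* v.adicCompletion K :=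
  letI := (finCompletionMap v w).toAlgebra
  Algebra.norm (v.adicCompletion K)

open scoped Valued in
theorem continuous_finLocalNorm : Continuous (finLocalNorm v w) := by
  let := (finCompletionMap v w).toAlgebra
  have : ContinuousSMul (v.adicCompletion K) (w.adicCompletion L) :=
    ⟨((continuous_finCompletionMap v w).comp continuous_fst).mul continuous_snd⟩
  have : IsScalarTower K (v.adicCompletion K) (w.adicCompletion L) :=
    .of_algebraMap_eq fun x => (finCompletionMap_coe v w x).symm
  have : Module.Finite (v.adicCompletion K) (w.adicCompletion L) := inferInstance
  let b := Module.finBasis (v.adicCompletion K) (w.adicCompletion L)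
  have h : ⇑(finLocalNorm v w) = fun y => (Algebra.leftMulMatrix b y).det := by
    funext y
    exact Algebra.norm_eq_matrix_det b y
  rw [h]
  exact (LinearMap.continuous_of_finiteDimensional
    (Algebra.leftMulMatrix b).toLinearMap).matrix_det

open scoped Valued in
theorem finLocalNorm_mem {y : w.adicCompletion L} (hy : y ∈ w.adicCompletionIntegers L) :
    finLocalNorm v w y ∈ v.adicCompletionIntegers K := by
  have hU : finLocalNorm v w ⁻¹' (v.adicCompletionIntegers K : Set (v.adicCompletion K)) ∈
      nhds (0 : w.adicCompletion L) := by
    let := (finCompletionMap v w).toAlgebra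
    have : ContinuousSMul (v.adicCompletion K) (w.adicCompletion L) :=
      ⟨((continuous_finCompletionMap v w).comp continuous_fst).mul continuous_snd⟩
    have : IsScalarTower K (v.adicCompletion K) (w.adicCompletion L) :=
      .of_algebraMap_eq fun x => (finCompletionMap_coe v w x).symm
    have : Module.Finite (v.adicCompletion K) (w.adicCompletion L) := inferInstance
    refine ((Valued.isOpen_valuationSubring _).preimage (continuous_finLocalNorm v w)).mem_nhds ?_
    have h0 : finLocalNorm v w 0 = 0 := Algebra.norm_zero
    rw [Set.mem_preimage, h0]
    exact zero_mem (v.adicCompletionIntegers K)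
  obtain ⟨γ, hγ⟩ := Valued.mem_nhds_zero.mp hU
  obtain ⟨π, hπ⟩ := v.valuedAdicCompletion_surjective K (WithZero.exp (-1))
  have hπ0 : π ≠ 0 := by
    rintro rfl
    rw [map_zero] at hπ
    exact WithZero.exp_ne_zero hπ.symm
  have hlim : Filter.Tendsto (fun m : ℕ => finCompletionMap v w (π ^ m)) Filter.atTop (nhds 0) := by
    have h1 : ‖π‖ < 1 := by
      rw [Valued.toNormedField.norm_lt_one_iff, hπ]
      exact WithZero.exp_lt_exp.mpr (by norm_num)
    have h2 := (continuous_finCompletionMap v w).tendsto 0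
    rw [map_zero] at h2
    exact h2.comp (tendsto_pow_atTop_nhds_zero_of_norm_lt_one h1)
  obtain ⟨m, hm⟩ := (hlim.eventually (Valued.mem_nhds_zero.mpr ⟨γ, subset_rfl⟩)).exists
  have key : ∀ n : ℕ, Valued.v (finLocalNorm v w (finCompletionMap v w (π ^ m))) *
      Valued.v (finLocalNorm v w y) ^ n ≤ 1 := by
    intro n
    rw [← map_pow, ← map_pow, ← map_mul, ← map_mul]
    refine hγ (lt_of_le_of_lt ?_ hm)
    rw [map_mul Valued.v.restrict, map_pow Valued.v.restrict]
    refine mul_le_of_le_one_right' (pow_le_one' ?_ n)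
    rw [← map_one Valued.v.restrict, Valuation.restrict_le_iff, map_one]
    exact hy
  by_contra hN
  rw [HeightOneSpectrum.notMem_adicCompletionIntegers] at hN
  set a := Valued.v (finLocalNorm v w (finCompletionMap v w (π ^ m))) with ha
  have ha0 : a ≠ 0 := by
    have hu : IsUnit (finLocalNorm v w (finCompletionMap v w (π ^ m))) :=
      ((IsUnit.mk0 _ (pow_ne_zero m hπ0)).map (finCompletionMap v w)).map (finLocalNorm v w)
    rw [ha, Valuation.ne_zero_iff]
    exact hu.ne_zero
  obtain ⟨n, hn⟩ := MulArchimedean.arch a⁻¹ hN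
  have h1 : a⁻¹ < Valued.v (finLocalNorm v w y) ^ (n + 1) :=
    hn.trans_lt (pow_lt_pow_right₀ hN (Nat.lt_succ_self n))
  have h2 := mul_lt_mul_of_pos_left h1 (zero_lt_iff.mpr ha0)
  rw [mul_inv_cancel₀ ha0] at h2
  exact absurd (key (n + 1)) (not_le.mpr h2)
end

variable (K L)

theorem finite_fiber (v : HeightOneSpectrum (𝓞 K)) :
    Finite {w : HeightOneSpectrum (𝓞 L) // w.asIdeal.LiesOver v.asIdeal} := by
  have : v.asIdeal.IsMaximal := v.isMaximal
  have h := IsDedekindDomain.primesOver_finite v.asIdeal (𝓞 L)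
  have : Finite (v.asIdeal.primesOver (𝓞 L)) := h
  refine Finite.of_injective
    (fun w : {w : HeightOneSpectrum (𝓞 L) // w.asIdeal.LiesOver v.asIdeal} =>
      (⟨w.1.asIdeal, w.1.isPrime, w.2⟩ : v.asIdeal.primesOver (𝓞 L))) ?_
  intro w w' h
  exact Subtype.ext (HeightOneSpectrum.ext (congrArg Subtype.val h))

theorem tendsto_under :
    Filter.Tendsto (HeightOneSpectrum.under (𝓞 K) : HeightOneSpectrum (𝓞 L) → _)
      Filter.cofinite Filter.cofinite := by
  refine Filter.Tendsto.cofinite_of_finite_preimage_singleton fun v => ?_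
  have := finite_fiber K L v
  refine (Set.finite_range (Subtype.val :
    {w : HeightOneSpectrum (𝓞 L) // w.asIdeal.LiesOver v.asIdeal} → _)).subset ?_
  rintro w rfl
  exact ⟨⟨w, ⟨rfl⟩⟩, rfl⟩

instance (w : HeightOneSpectrum (𝓞 L)) :
    w.asIdeal.LiesOver (w.under (𝓞 K)).asIdeal := ⟨rfl⟩

/-- The canonical homomorphism from the adeles of `K` to the adeles of `L`: the component at a
place `w` of `L` is the image of the component at the place `v` of `K` under `w`, by the
continuous extension `K_v → L_w` of `K → L`. -/
noncomputable def adeleMap : AdeleRing (𝓞 K) K →+* AdeleRing (𝓞 L) L :=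
  RingHom.prodMap
    (RingHom.pi fun w : InfinitePlace L =>
      haveI := comap_liesOver K L w
      (NumberField.LiesOver.completionMap (v := w.comap (algebraMap K L)) (w := w)).comp
        (Pi.evalRingHom (fun v : InfinitePlace K => v.Completion) (w.comap (algebraMap K L))) :
      InfiniteAdeleRing K →+* InfiniteAdeleRing L)
    (RestrictedProduct.mapAlongRingHom
      (fun v : HeightOneSpectrum (𝓞 K) => v.adicCompletion K)
      (fun w : HeightOneSpectrum (𝓞 L) => w.adicCompletion L)
      (HeightOneSpectrum.under (𝓞 K)) (tendsto_under K L)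
      (fun w => finCompletionMap (w.under (𝓞 K)) w)
      (Filter.Eventually.of_forall fun w _ hx => finCompletionMap_mem _ w hx) :
      FiniteAdeleRing (𝓞 K) K →+* FiniteAdeleRing (𝓞 L) L)

theorem adeleMap_algebraMap (x : K) :
    adeleMap K L (algebraMap K (AdeleRing (𝓞 K) K) x) =
      algebraMap L (AdeleRing (𝓞 L) L) (algebraMap K L x) := by
  refine Prod.ext ?_ ?_
  · funext w
    have := comap_liesOver K L w
    exact (NumberField.LiesOver.completionMap_coe
      ((WithAbs.equiv (w.comap (algebraMap K L)).1).symm x)).trans rfl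
  · apply FiniteAdeleRing.ext
    intro w
    exact finCompletionMap_coe (w.under (𝓞 K)) w x

/-- The canonical homomorphism `L ⊗[K] 𝔸_K → 𝔸_L`, `l ⊗ a ↦ l a`. -/
noncomputable def adeleBaseChange : L ⊗[K] AdeleRing (𝓞 K) K →+* AdeleRing (𝓞 L) L :=
  letI : Algebra K (AdeleRing (𝓞 L) L) := Algebra.compHom _ (algebraMap K L)
  (Algebra.TensorProduct.lift
    ({ algebraMap L (AdeleRing (𝓞 L) L) with commutes' := fun _ => rfl } :
      L →ₐ[K] AdeleRing (𝓞 L) L)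
    ({ adeleMap K L with commutes' := fun x => adeleMap_algebraMap K L x } :
      AdeleRing (𝓞 K) K →ₐ[K] AdeleRing (𝓞 L) L)
    fun _ _ => Commute.all _ _).toRingHom

theorem adeleBaseChange_tmul (l : L) (a : AdeleRing (𝓞 K) K) :
    adeleBaseChange K L (l ⊗ₜ a) = algebraMap L (AdeleRing (𝓞 L) L) l * adeleMap K L a := rfl

variable {K L} in
/-- The local norm `L_w → K_v` at an infinite place `w` of `L` over `v`. -/
noncomputable def infLocalNorm (v : InfinitePlace K) (w : InfinitePlace L) [w.LiesOver v] :
    w.Completion →* v.Completion :=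
  letI := (NumberField.LiesOver.completionMap (v := v) (w := w)).toAlgebra
  Algebra.norm v.Completion

/-- The norm on infinite adeles: the component at `v` is the product over the places `w` over `v`
of the local norms. -/
noncomputable def infNorm : InfiniteAdeleRing L →* InfiniteAdeleRing K where
  toFun y := fun v => ∏ᶠ w : {w : InfinitePlace L // w.LiesOver v},
    haveI := w.2
    infLocalNorm v w.1 (y w.1)
  map_one' := by
    funext v
    refine (finprod_congr fun w => ?_).trans finprod_one
    have := w.2
    exact map_one (infLocalNorm v w.1)
  map_mul' y z := by
    funext v
    refine (finprod_congr fun w => ?_).trans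
      (finprod_mul_distrib (Set.toFinite _) (Set.toFinite _))
    have := w.2
    exact map_mul (infLocalNorm v w.1) _ _

/-- The norm on finite adeles: the component at `v` is the product over the primes `w` over `v`
of the local norms. -/
noncomputable def finNorm : FiniteAdeleRing (𝓞 L) L →* FiniteAdeleRing (𝓞 K) K where
  toFun y := ⟨fun v => ∏ᶠ w : {w : HeightOneSpectrum (𝓞 L) // w.asIdeal.LiesOver v.asIdeal},
    haveI := w.2
    finLocalNorm v w.1 (y w.1), by
      have hbad : {w : HeightOneSpectrum (𝓞 L) | ¬ y w ∈ w.adicCompletionIntegers L}.Finite := y.2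
      refine (hbad.image (HeightOneSpectrum.under (𝓞 K))).subset ?_
      intro v hv
      by_contra hv'
      refine hv (finprod_induction (· ∈ v.adicCompletionIntegers K) (one_mem _)
        (fun _ _ => mul_mem) fun w => ?_)
      have := w.2
      refine finLocalNorm_mem v w.1 ?_
      by_contra hw
      exact hv' ⟨w.1, hw, HeightOneSpectrum.ext w.2.over.symm⟩⟩
  map_one' := by
    apply FiniteAdeleRing.ext
    intro v
    refine (finprod_congr fun w => ?_).trans finprod_one
    have := w.2
    exact map_one (finLocalNorm v w.1)
  map_mul' y z := by
    apply FiniteAdeleRing.ext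
    intro v
    have := finite_fiber K L v
    refine (finprod_congr fun w => ?_).trans
      (finprod_mul_distrib (Set.toFinite _) (Set.toFinite _))
    have := w.2
    exact map_mul (finLocalNorm v w.1) _ _

/-- The idele norm `𝕀_L → 𝕀_K`: the component at `v` of the norm of `y` is the product over the
places `w` of `L` over `v` of the local norms `N_{L_w/K_v}(y_w)`. -/
noncomputable def ideleNorm : (AdeleRing (𝓞 L) L)ˣ →* (AdeleRing (𝓞 K) K)ˣ :=
  Units.map ((infNorm K L).prodMap (finNorm K L) : AdeleRing (𝓞 L) L →* AdeleRing (𝓞 K) K)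

end Adeles

end QuasiSplitTorus

/-! For every `K`-algebra `R` the determinant of multiplication gives a norm `L ⊗[K] R → R`, natural
in `R` because its matrix can be written in a `K`-basis of `L` (`tensorNorm_map`). If `L ⊗[K] R`
splits as a product of finite free `R`-algebras, this norm is the product of the norms of the
factors (`tensorNorm_eq_prod`). Parts (b) and (c) are this one formula read over two kinds of `R`.

Over an `E`-algebra, independence of characters makes the matrix of the embeddings `K' → E`
invertible, so `K' ⊗[K] R` is `R^Ω` (`tensorEval_cosetEmb_bijective`). Every factor has norm the
identity, so the norm is the product of the coset characters, which is what `ι(1)` prescribes.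
Uniqueness follows because every `R` embeds in the `E`-algebra `E ⊗[K] R`. The same splitting
reduces the characters of the Weil restriction to those of `G_m`. These are read off at the
universal unit `T` of the Laurent polynomial ring, whose units are monomials
(`exists_zpow_of_natural`).

Over `K_v`, `L ⊗[K] K_v` is the product of the `L_w` with `w` over `v`, and the formula gives the
product of local norms. In coordinates for a basis of `L` over `K`, surjectivity is weak
approximation together with closedness of finite-dimensional subspaces. Injectivity at infinite
places is a count of local degrees. At primes it comes from pairing with the trace-dual basis:
coordinates of an integral element are integral up to a denominator `c` that does not depend on `v`
(`mul_coord_mem_integers`). The same uniform bound makes the local preimages of an adele integral at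
almost all primes, whence `adeleBaseChange` is bijective. -/

namespace QuasiSplitTorus

/-! ### Splitting of `K' ⊗[K] R` over `E`-algebras -/

section Splitting

theorem cosetEmb_injective {K E : Type u} [Field K] [Field E] [Algebra K E]
    (K' : IntermediateField K E) : Function.Injective (cosetEmb K') := by
  intro ω ω' h
  induction ω using Quotient.inductionOn' with
  | h g =>
    induction ω' using Quotient.inductionOn' with
    | h g' =>
      refine Quotient.sound' ?_
      rw [QuotientGroup.leftRel_apply, IntermediateField.mem_fixingSubgroup_iff]
      intro x hx
      have h1 : g x = g' x := DFunLike.congr_fun h (⟨x, hx⟩ : K')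
      rw [AlgEquiv.mul_apply, ← h1]
      exact g.symm_apply_apply x

theorem tensorEval_tmul {K L A : Type u} [Field K] [Field L] [Algebra K L] [CommRing A]
    [Algebra K A] (a : L →ₐ[K] A) (l : L) (r : A) : tensorEval a (l ⊗ₜ r) = a l * r :=
  Algebra.TensorProduct.lift_tmul _ _ _ _ _

/-- Coordinates on `L ⊗[K] R` with respect to a basis of `L` over `K`. -/
noncomputable def tensorCoord {K L : Type u} {ι : Type*} [Field K] [Field L] [Algebra K L]
    [Fintype ι] [DecidableEq ι] (b : Module.Basis ι K L) (R : Type u) [CommRing R] [Algebra K R] :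
    (L ⊗[K] R) ≃ₗ[K] (ι → R) :=
  (TensorProduct.equivFinsuppOfBasisLeft b).trans (Finsupp.linearEquivFunOnFinite K R ι)

section TensorCoord

variable {K L R : Type u} {ι : Type*} [Field K] [Field L] [Algebra K L] [CommRing R] [Algebra K R]
  [Fintype ι] [DecidableEq ι] (b : Module.Basis ι K L)

theorem tensorCoord_tmul (l : L) (r : R) (k : ι) :
    tensorCoord b R (l ⊗ₜ r) k = b.repr l k • r := by
  simp [tensorCoord]

theorem tensorCoord_symm_apply (x : ι → R) : (tensorCoord b R).symm x = ∑ i, b i ⊗ₜ x i := by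
  rw [LinearEquiv.symm_apply_eq]
  ext k
  simp [tensorCoord]

end TensorCoord

/-- A family of homomorphisms `L → A` of `K`-algebras whose matrix on a basis of `L` is invertible
splits `L ⊗[K] A`. -/
theorem tensorEval_bijective_of_matrix {K L A ι J : Type u} [Field K] [Field L] [Algebra K L]
    [CommRing A] [Algebra K A] [Fintype ι] [Fintype J] [DecidableEq ι] [DecidableEq J]
    (b : Module.Basis ι K L) (a : J → L →ₐ[K] A)
    (N : Matrix ι J A) (h1 : N * Matrix.of (fun j i => a j (b i)) = 1)
    (h2 : Matrix.of (fun j i => a j (b i)) * N = 1) :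
    Function.Bijective fun (z : L ⊗[K] A) (j : J) => tensorEval (a j) z := by
  have key : ∀ z : L ⊗[K] A, (fun j => tensorEval (a j) z) =
      (Matrix.of (fun j i => a j (b i))).mulVec (tensorCoord b A z) := by
    intro z
    funext j
    induction z with
    | zero => simp
    | add z w hz hw => simp only [map_add, hz, hw, Matrix.mulVec_add, Pi.add_apply]
    | tmul l r =>
      rw [tensorEval_tmul]
      simp only [Matrix.mulVec, dotProduct, Matrix.of_apply, tensorCoord_tmul, mul_smul_comm, ← smul_mul_assoc]
      rw [← Finset.sum_mul]
      conv_lhs => rw [← b.sum_repr l, map_sum]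
      simp only [map_smul]
  have : (fun (z : L ⊗[K] A) (j : J) => tensorEval (a j) z) =
      (fun x => (Matrix.of (fun j i => a j (b i))).mulVec x) ∘ tensorCoord b A := funext key
  rw [this]
  refine Function.Bijective.comp ?_ (tensorCoord b A).bijective
  refine Function.bijective_iff_has_inverse.mpr ⟨fun y => N.mulVec y, fun x => ?_, fun y => ?_⟩
  · simp only [Matrix.mulVec_mulVec, h1, Matrix.one_mulVec]
  · simp only [Matrix.mulVec_mulVec, h2, Matrix.one_mulVec]

variable {K E : Type u} [Field K] [Field E] [Algebra K E] [FiniteDimensional K E] [IsGalois K E]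

/-- For every `E`-algebra `R`, the embeddings attached to the cosets of `G_{K'}` split
`K' ⊗[K] R`. -/
theorem tensorEval_cosetEmb_bijective (K' : IntermediateField K E) (R : CommAlgCat.{u} E) :
    Function.Bijective fun (z : K' ⊗[K] ((restrict (algebraMap K E)).obj R))
      (ω : Gal(E/K) ⧸ K'.fixingSubgroup) => tensorEval (embPoint (cosetEmb K' ω) R) z := by
  classical
  have := Fintype.ofFinite (Gal(E/K) ⧸ K'.fixingSubgroup)
  let ι := Module.Free.ChooseBasisIndex K K'
  let b : Module.Basis ι K K' := Module.Free.chooseBasis K K'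
  -- By the Galois correspondence `[K' : K]` is the index of the fixing subgroup, so the matrix of
  -- embeddings against basis vectors is square.
  have hcard : Fintype.card ι = Fintype.card (Gal(E/K) ⧸ K'.fixingSubgroup) := by
    rw [← Module.finrank_eq_card_basis b, IntermediateField.finrank_eq_fixingSubgroup_index,
      Subgroup.index, Nat.card_eq_fintype_card]
  let e : ι ≃ Gal(E/K) ⧸ K'.fixingSubgroup := Fintype.equivOfCardEq hcard
  let M : Matrix ι ι E := Matrix.of fun i j => cosetEmb K' (e i) (b j)
  -- Dedekind: distinct embeddings are linearly independent over `E`. Evaluation on the basis turns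
  -- the embeddings into the rows of `M`, so `M` is invertible over `E`, and its inverse is then
  -- pushed forward to `R`.
  have hli : LinearIndependent E M.row := by
    have h1 := (linearIndependent_toLinearMap K K' E).comp (fun i => cosetEmb K' (e i))
      ((cosetEmb_injective K').comp e.injective)
    have h2 := h1.map' (b.constr E).symm.toLinearMap (LinearEquiv.ker _)
    exact h2
  rw [Matrix.linearIndependent_rows_iff_isUnit] at hli
  obtain ⟨N, hN1, hN2⟩ := isUnit_iff_exists.mp hli
  let f : E →+* (restrict (algebraMap K E)).obj R := algebraMap E R
  refine tensorEval_bijective_of_matrix b (fun ω => embPoint (cosetEmb K' ω) R)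
    ((N.map f).submatrix id e.symm) ?_ ?_
  · have : (Matrix.of fun ω i => embPoint (cosetEmb K' ω) R (b i)) =
        (M.map f).submatrix e.symm id := by
      ext ω i
      simp [M, f]
      rfl
    rw [this, Matrix.submatrix_mul_equiv, ← Matrix.map_mul, hN2, Matrix.map_one _ f.map_zero f.map_one,
      Matrix.submatrix_id_id]
  · have : (Matrix.of fun ω i => embPoint (cosetEmb K' ω) R (b i)) =
        (M.map f).submatrix e.symm id := by
      ext ω i
      simp [M, f]
      rfl
    rw [this, ← Matrix.submatrix_mul _ _ _ _ _ Function.bijective_id, ← Matrix.map_mul, hN1,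
      Matrix.map_one _ f.map_zero f.map_one, Matrix.submatrix_one_equiv]

end Splitting

/-! ### Characters of `G_m` -/

section Characters

-- Clearing denominators in `u` and its inverse gives two polynomials whose product is a power of
-- `X`. As `X` is prime, each is a unit times a power of `X`.
open LaurentPolynomial in
theorem _root_.LaurentPolynomial.exists_eq_C_mul_T_of_isUnit {F : Type u} [Field F]
    {u : LaurentPolynomial F} (hu : IsUnit u) : ∃ (c : F) (n : ℤ), u = C c * T n := by
  obtain ⟨u', h⟩ := hu.exists_right_inv
  obtain ⟨m, p, hp⟩ := exists_T_pow u
  obtain ⟨m', q, hq⟩ := exists_T_pow u'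
  have hpq : p * q = Polynomial.X ^ (m + m') := by
    apply Polynomial.toLaurent_injective
    rw [map_mul, hp, hq, Polynomial.toLaurent_X_pow, mul_mul_mul_comm, h, one_mul, ← T_add]
    push_cast
    rfl
  obtain ⟨i, -, hi⟩ := (dvd_prime_pow Polynomial.prime_X _).mp ⟨q, hpq.symm⟩
  obtain ⟨w, hw⟩ := hi.symm
  obtain ⟨c, -, hc⟩ := Polynomial.isUnit_iff.mp w.isUnit
  refine ⟨c, i - m, ?_⟩
  have h2 : u * T (m : ℤ) = T i * C c := by
    rw [← hp, ← hw, ← hc, map_mul, Polynomial.toLaurent_X_pow, Polynomial.toLaurent_C]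
  calc u = u * T (m : ℤ) * T (-m : ℤ) := by rw [mul_T_assoc, add_neg_cancel, T_zero, mul_one]
    _ = C c * T (i - m) := by rw [h2, mul_comm (T _) (C c), mul_assoc, ← T_add, sub_eq_add_neg]

/-- The Laurent polynomial ring as an `E`-algebra. -/
noncomputable def laurentAlg (E : Type u) [Field E] : CommAlgCat.{u} E :=
  CommAlgCat.of E (LaurentPolynomial E)

/-- The universal unit. -/
noncomputable def laurentUnit (E : Type u) [Field E] : (laurentAlg E)ˣ :=
  (LaurentPolynomial.isUnit_T (R := E) 1).unit

/-- The homomorphism from the Laurent polynomial ring with a given value at the universal unit. -/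
noncomputable def laurentEval {E : Type u} [Field E] {R : CommAlgCat.{u} E} (x : Rˣ) :
    laurentAlg E ⟶ R :=
  CommAlgCat.ofHom { LaurentPolynomial.eval₂ (algebraMap E R) x with
    commutes' := fun c => LaurentPolynomial.eval₂_C (algebraMap E R) x c }

theorem laurentEval_C_mul_T {E : Type u} [Field E] {R : CommAlgCat.{u} E} (x : Rˣ) (c : E)
    (n : ℤ) : (laurentEval x).hom (LaurentPolynomial.C c * LaurentPolynomial.T n :
      LaurentPolynomial E) = algebraMap E R c * (x ^ n : Rˣ) :=
  LaurentPolynomial.eval₂_C_mul_T (algebraMap E R) x c n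

theorem map_laurentUnit {E : Type u} [Field E] {R : CommAlgCat.{u} E} (x : Rˣ) :
    Units.map ((laurentEval x).hom : _ →* _) (laurentUnit E) = x := by
  ext
  have := laurentEval_C_mul_T x 1 1
  rw [map_one, map_one, one_mul, one_mul, zpow_one] at this
  exact this

/-- Distinct powers of `T` are distinct basis elements of the group algebra of `ℤ`. Evaluation at
the universal unit therefore detects exponents. -/
theorem laurentUnit_zpow_injective (E : Type u) [Field E] :
    Function.Injective fun n : ℤ => laurentUnit E ^ n := by
  let h : Multiplicative ℤ →* (LaurentPolynomial E)ˣ :=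
    MonoidHom.toHomUnits (AddMonoidAlgebra.of E ℤ)
  have h1 : laurentUnit E = h (Multiplicative.ofAdd 1) := Units.ext rfl
  have h2 : ∀ n : ℤ, laurentUnit E ^ n = h (Multiplicative.ofAdd n) := by
    intro n
    rw [h1]
    refine (map_zpow h (Multiplicative.ofAdd 1) n).symm.trans ?_
    rw [← ofAdd_zsmul, smul_eq_mul, mul_one]
  intro n m hnm
  simp only [h2] at hnm
  exact Multiplicative.ofAdd.injective
    (AddMonoidAlgebra.of_injective (R := E) (M := ℤ) (congrArg Units.val hnm))

/-- A natural family of endomorphisms of the unit groups of the `E`-algebras is a power map. -/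
theorem exists_zpow_of_natural {E : Type u} [Field E] (f : ∀ R : CommAlgCat.{u} E, Rˣ →* Rˣ)
    (hf : ∀ {R S : CommAlgCat.{u} E} (φ : R ⟶ S) (x : Rˣ),
      f S (Units.map (φ.hom : _ →* _) x) = Units.map (φ.hom : _ →* _) (f R x)) :
    ∃ n : ℤ, ∀ (R : CommAlgCat.{u} E) (x : Rˣ), f R x = x ^ n := by
  obtain ⟨c, n, hc⟩ := LaurentPolynomial.exists_eq_C_mul_T_of_isUnit
    (u := (f (laurentAlg E) (laurentUnit E)).val)
    (Units.isUnit (f (laurentAlg E) (laurentUnit E)))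
  have key : ∀ (R : CommAlgCat.{u} E) (x : Rˣ),
      (f R x : R) = algebraMap E R c * (x ^ n : Rˣ) := by
    intro R x
    rw [← laurentEval_C_mul_T x c n, ← hc]
    conv_lhs => rw [← map_laurentUnit x, hf]
    rfl
  refine ⟨n, fun R x => Units.ext ?_⟩
  -- A homomorphism sends `1` to `1`, which forces the image of the constant `c` in `R` to be `1`.
  have h1 := key R 1
  rw [map_one, one_zpow, Units.val_one, mul_one] at h1
  rw [key, ← h1, one_mul]

theorem gmCharMap_apply {K E : Type u} [Field K] [Field E] [Algebra K E] (n : ℤ) :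
    (gmCharMap K E n).toMul = idChar K E ^ n := by
  change (LinearMap.toSpanSingleton ℤ _ (Additive.ofMul (idChar K E)) n).toMul = _
  rw [LinearMap.toSpanSingleton_apply, toMul_zsmul]
  rfl

/-- Evaluation of characters at an `R`-point. -/
def evalHom {K E : Type u} [Field K] [Field E] [Algebra K E] {T : AffineGroupScheme K}
    (R : CommAlgCat.{u} E) (x : T.points.obj ((restrict (algebraMap K E)).obj R)) :
    CharGroup E T →* Rˣ where
  toFun χ := χ.eval R x
  map_one' := rfl
  map_mul' _ _ := rfl

theorem zpow_eval {K E : Type u} [Field K] [Field E] [Algebra K E] {T : AffineGroupScheme K}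
    (χ : CharGroup E T) (n : ℤ) (R : CommAlgCat.{u} E)
    (x : T.points.obj ((restrict (algebraMap K E)).obj R)) :
    (χ ^ n).eval R x = χ.eval R x ^ n :=
  map_zpow (evalHom R x) χ n

theorem gmCharMap_bijective (K E : Type u) [Field K] [Field E] [Algebra K E] :
    Function.Bijective (gmCharMap K E) := by
  constructor
  · intro n m h
    apply laurentUnit_zpow_injective E
    have h1 := congrArg (fun χ : Additive (CharGroup E (Gm K)) =>
      χ.toMul.eval (laurentAlg E) (laurentUnit E)) h
    simp only [gmCharMap_apply] at h1
    exact (zpow_eval _ n _ _).symm.trans (h1.trans (zpow_eval _ m _ _))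
  · intro χ
    obtain ⟨n, hn⟩ := exists_zpow_of_natural (fun R => (NatTrans.app χ.toMul R).hom)
      (fun φ x => χ.toMul.eval_natural φ x)
    refine ⟨n, ?_⟩
    apply Additive.toMul.injective
    rw [gmCharMap_apply]
    apply CharGroup.ext
    intro R x
    rw [zpow_eval]
    exact (hn R x).symm

end Characters

/-! ### Characters of the Weil restriction -/

section ResCharacters

variable {K E : Type u} [Field K] [Field E] [Algebra K E] [FiniteDimensional K E]

theorem resCharMap_apply (K' : IntermediateField K E)
    [Fintype (Gal(E/K) ⧸ K'.fixingSubgroup)]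
    (m : MonoidAlgebra ℤ (Gal(E/K) ⧸ K'.fixingSubgroup)) :
    (resCharMap K' m).toMul = ∏ ω, embChar (cosetEmb K' ω) ^ (m.coeff ω) := by
  change (Finsupp.linearCombination ℤ (fun ω =>
    (Additive.ofMul (embChar (cosetEmb K' ω)) : Additive (CharGroup E (ResGm K K')))) m.coeff).toMul
    = _
  rw [Finsupp.linearCombination_apply]
  refine (congrArg Additive.toMul (Finsupp.sum_fintype _ _ fun ω =>
    zero_smul ℤ (Additive.ofMul (embChar (cosetEmb K' ω)) :
      Additive (CharGroup E (ResGm K K'))))).trans ?_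
  rw [toMul_sum]
  rfl

theorem resCharMap_eval (K' : IntermediateField K E)
    [Fintype (Gal(E/K) ⧸ K'.fixingSubgroup)]
    (m : MonoidAlgebra ℤ (Gal(E/K) ⧸ K'.fixingSubgroup)) (R : CommAlgCat.{u} E)
    (z : (K' ⊗[K] ((restrict (algebraMap K E)).obj R))ˣ) :
    (resCharMap K' m).toMul.eval R z = ∏ ω, (embChar (cosetEmb K' ω)).eval R z ^ (m.coeff ω) := by
  rw [resCharMap_apply]
  refine (map_prod (evalHom (T := ResGm K K') R z) _ _).trans ?_
  exact Finset.prod_congr rfl fun ω _ => zpow_eval _ _ _ _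

variable [IsGalois K E]

/-- The splitting `K' ⊗[K] R ≃ R^Ω` for an `E`-algebra `R`. -/
noncomputable def splitEquiv (K' : IntermediateField K E) (R : CommAlgCat.{u} E) :
    (K' ⊗[K] ((restrict (algebraMap K E)).obj R)) ≃+*
      ((Gal(E/K) ⧸ K'.fixingSubgroup) → (restrict (algebraMap K E)).obj R) :=
  RingEquiv.ofBijective
    (RingHom.pi fun ω => (tensorEval (embPoint (cosetEmb K' ω) R)).toRingHom)
    (tensorEval_cosetEmb_bijective K' R)

theorem splitEquiv_apply (K' : IntermediateField K E) (R : CommAlgCat.{u} E)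
    (z : K' ⊗[K] ((restrict (algebraMap K E)).obj R)) (ω : Gal(E/K) ⧸ K'.fixingSubgroup) :
    splitEquiv K' R z ω = tensorEval (embPoint (cosetEmb K' ω) R) z := rfl

/-- The splitting on unit groups. -/
noncomputable def splitUnits (K' : IntermediateField K E) (R : CommAlgCat.{u} E) :
    (K' ⊗[K] ((restrict (algebraMap K E)).obj R))ˣ ≃* ((Gal(E/K) ⧸ K'.fixingSubgroup) → Rˣ) :=
  (Units.mapEquiv (splitEquiv K' R).toMulEquiv).trans
    (MulEquiv.piUnits (M := fun _ : Gal(E/K) ⧸ K'.fixingSubgroup => R))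

theorem splitUnits_apply (K' : IntermediateField K E) (R : CommAlgCat.{u} E)
    (z : (K' ⊗[K] ((restrict (algebraMap K E)).obj R))ˣ) (ω : Gal(E/K) ⧸ K'.fixingSubgroup) :
    splitUnits K' R z ω = (embChar (cosetEmb K' ω)).eval R z := Units.ext rfl

theorem splitUnits_natural (K' : IntermediateField K E) {R S : CommAlgCat.{u} E} (φ : R ⟶ S)
    (y : (Gal(E/K) ⧸ K'.fixingSubgroup) → Rˣ) :
    ((ResGm K K').points.map ((restrict (algebraMap K E)).map φ)).hom ((splitUnits K' R).symm y) =
      (splitUnits K' S).symm (fun ω => Units.map (φ.hom : _ →* _) (y ω)) := by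
  refine ((splitUnits K' S).symm_apply_eq.mpr ?_).symm
  funext ω
  refine Eq.trans ?_ (splitUnits_apply K' S _ ω).symm
  refine Eq.trans ?_ ((embChar (cosetEmb K' ω)).eval_natural φ ((splitUnits K' R).symm y)).symm
  rw [← splitUnits_apply, MulEquiv.apply_symm_apply]

/-- Under the splitting the torus becomes `G_m^Ω`. A character is then determined by its
restrictions to the coordinate copies of `G_m`, each of which is a power map; the exponents are the
coefficients in `ℤΩ`. -/
theorem resCharMap_bijective (K' : IntermediateField K E) :
    Function.Bijective (resCharMap K') := by
  classical
  have := Fintype.ofFinite (Gal(E/K) ⧸ K'.fixingSubgroup)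
  constructor
  · intro m m' h
    apply MonoidAlgebra.coeff_injective
    ext ω
    apply laurentUnit_zpow_injective E
    -- The test point has the universal unit in coordinate `ω` and `1` elsewhere, so its value under
    -- the character isolates the coefficient at `ω`.
    have h1 := congrArg (fun χ : Additive (CharGroup E (ResGm K K')) =>
      χ.toMul.eval (laurentAlg E) ((splitUnits K' (laurentAlg E)).symm
        (Pi.mulSingle ω (laurentUnit E)))) h
    have key : ∀ m : MonoidAlgebra ℤ (Gal(E/K) ⧸ K'.fixingSubgroup),
        (resCharMap K' m).toMul.eval (laurentAlg E) ((splitUnits K' (laurentAlg E)).symm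
          (Pi.mulSingle ω (laurentUnit E))) = laurentUnit E ^ (m.coeff ω) := by
      intro m
      rw [resCharMap_eval, Finset.prod_eq_single ω]
      · rw [← splitUnits_apply, MulEquiv.apply_symm_apply, Pi.mulSingle_eq_same]
      · intro ω' _ hω'
        rw [← splitUnits_apply, MulEquiv.apply_symm_apply, Pi.mulSingle_eq_of_ne hω', one_zpow]
      · intro h
        exact absurd (Finset.mem_univ _) h
    exact (key m).symm.trans (h1.trans (key m'))
  · intro χ
    have hn : ∀ ω, ∃ n : ℤ, ∀ (R : CommAlgCat.{u} E) (x : Rˣ),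
        χ.toMul.eval R ((splitUnits K' R).symm (Pi.mulSingle ω x)) = x ^ n := by
      intro ω
      refine exists_zpow_of_natural (fun R => ((NatTrans.app χ.toMul R).hom).comp
        ((splitUnits K' R).symm.toMonoidHom.comp
          (MonoidHom.mulSingle (fun _ : Gal(E/K) ⧸ K'.fixingSubgroup => Rˣ) ω))) ?_
      intro R S φ x
      refine Eq.trans ?_ (χ.toMul.eval_natural φ _)
      refine congrArg (χ.toMul.eval S) (Eq.trans ?_ (splitUnits_natural K' φ _).symm)
      refine congrArg (splitUnits K' S).symm ?_
      funext ω'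
      exact (Pi.apply_mulSingle (fun _ => Units.map (φ.hom : R →* S))
        (fun _ => map_one _) ω x ω').symm
    choose n hn using hn
    refine ⟨MonoidAlgebra.ofCoeff (Finsupp.equivFunOnFinite.symm n), ?_⟩
    apply Additive.toMul.injective
    apply CharGroup.ext
    intro R z
    refine (resCharMap_eval K' _ R z).trans ?_
    let g : ((Gal(E/K) ⧸ K'.fixingSubgroup) → Rˣ) →* Rˣ :=
      ((NatTrans.app χ.toMul R).hom).comp (splitUnits K' R).symm.toMonoidHom
    have hz : χ.toMul.eval R z = g (splitUnits K' R z) :=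
      congrArg (χ.toMul.eval R) ((splitUnits K' R).symm_apply_apply z).symm
    refine Eq.trans ?_ hz.symm
    -- A point of `(Rˣ)^Ω` is the product of its single-coordinate parts, and multiplicativity
    -- reduces the claim to `hn`.
    rw [← Finset.univ_prod_mulSingle (splitUnits K' R z), map_prod]
    refine Finset.prod_congr rfl fun ω _ => ?_
    refine Eq.trans ?_ (hn ω R _).symm
    exact congrArg (· ^ n ω) (splitUnits_apply K' R z ω).symm


end ResCharacters

/-! ### The norm on `L ⊗[K] R` and its behaviour on products -/

section Norm

theorem _root_.Matrix.det_blockDiagonal' {R J : Type*} [CommRing R] [Fintype J] [DecidableEq J]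
    {n : J → Type*} [∀ j, Fintype (n j)] [∀ j, DecidableEq (n j)]
    (M : ∀ j, Matrix (n j) (n j) R) :
    (Matrix.blockDiagonal' M).det = ∏ j, (M j).det := by
  -- The index type carries no order; an arbitrary one makes the block-diagonal matrix block
  -- triangular.
  let : LinearOrder J := IsWellOrder.linearOrder WellOrderingRel
  have h : (Matrix.blockDiagonal' M).BlockTriangular Sigma.fst := by
    rintro ⟨i, k⟩ ⟨j, l⟩ hij
    exact Matrix.blockDiagonal'_apply_ne M k l hij.ne'
  rw [h.det_fintype]
  refine Finset.prod_congr rfl fun j _ => ?_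
  rw [← Matrix.det_submatrix_equiv_self (Equiv.sigmaSubtype j) (M j)]
  congr 1
  ext ⟨⟨i, k⟩, hi⟩ ⟨⟨i', l⟩, hi'⟩
  obtain rfl : i = j := hi
  obtain rfl : i' = i := hi'
  exact Matrix.blockDiagonal'_apply_eq M i' k l

/-- In the basis assembled from bases of the factors, multiplication by `x` is block diagonal. -/
theorem _root_.Algebra.norm_pi {R : Type*} [CommRing R] {J : Type*} [Fintype J] (S : J → Type*)
    [∀ j, CommRing (S j)] [∀ j, Algebra R (S j)] [∀ j, Module.Free R (S j)]
    [∀ j, Module.Finite R (S j)] (x : ∀ j, S j) :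
    Algebra.norm R x = ∏ j, Algebra.norm R (x j) := by
  classical
  let b := fun j => Module.Free.chooseBasis R (S j)
  rw [Algebra.norm_eq_matrix_det (Pi.basis b)]
  have : Algebra.leftMulMatrix (Pi.basis b) x =
      Matrix.blockDiagonal' fun j => Algebra.leftMulMatrix (b j) (x j) := by
    ext ⟨i, k⟩ ⟨j, l⟩
    rw [Algebra.leftMulMatrix_eq_repr_mul, Pi.basis_repr, Matrix.blockDiagonal'_apply]
    by_cases h : i = j
    · subst h
      simp [Algebra.leftMulMatrix_eq_repr_mul, Pi.basis_apply]
    · simp [h, Pi.basis_apply]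
  rw [this, Matrix.det_blockDiagonal']
  exact Finset.prod_congr rfl fun j _ => (Algebra.norm_eq_matrix_det (b j) (x j)).symm

variable {K L : Type u} [Field K] [Field L] [Algebra K L]

/-- The norm `L ⊗[K] R → R`. -/
noncomputable def tensorNorm (K L R : Type u) [Field K] [Field L] [Algebra K L] [CommRing R]
    [Algebra K R] : L ⊗[K] R →* R :=
  (Algebra.norm R : R ⊗[K] L →* R).comp (Algebra.TensorProduct.comm K L R : L ⊗[K] R →* R ⊗[K] L)

theorem tensorNorm_apply {R : Type u} [CommRing R] [Algebra K R] (z : L ⊗[K] R) :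
    tensorNorm K L R z = Algebra.norm R (Algebra.TensorProduct.comm K L R z) := rfl

/-- The norm on `L ⊗[K] R` is natural in `R`. -/
theorem tensorNorm_map [FiniteDimensional K L] {R S : Type u} [CommRing R] [Algebra K R]
    [CommRing S] [Algebra K S] (f : R →ₐ[K] S) (z : L ⊗[K] R) :
    tensorNorm K L S (Algebra.TensorProduct.map (AlgHom.id L L) f z) = f (tensorNorm K L R z) := by
  classical
  let b := Module.Free.chooseBasis K L
  rw [tensorNorm_apply, tensorNorm_apply,
    Algebra.norm_eq_matrix_det (Algebra.TensorProduct.basis S b),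
    Algebra.norm_eq_matrix_det (Algebra.TensorProduct.basis R b), AlgHom.map_det]
  congr 1
  induction z with
  | zero => simp
  | add z w hz hw => simp only [map_add, hz, hw]
  | tmul l r =>
    ext i j
    simp [Algebra.leftMulMatrix_eq_repr_mul]

/-- If `L ⊗[K] R` is a product of free `R`-algebras, its norm is the product of their norms. -/
theorem tensorNorm_eq_prod [FiniteDimensional K L] {R : Type u} [CommRing R] [Algebra K R]
    {J : Type*} [Fintype J] (S : J → Type*) [∀ j, CommRing (S j)] [∀ j, Algebra R (S j)]
    [∀ j, Module.Free R (S j)] [∀ j, Module.Finite R (S j)] (e : L ⊗[K] R ≃+* (∀ j, S j))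
    (he : ∀ r j, e (1 ⊗ₜ r) j = algebraMap R (S j) r) (z : L ⊗[K] R) :
    tensorNorm K L R z = ∏ j, Algebra.norm R (e z j) := by
  let e' : R ⊗[K] L ≃ₐ[R] (∀ j, S j) := AlgEquiv.ofRingEquiv
    (f := (Algebra.TensorProduct.comm K L R).symm.toRingEquiv.trans e) (fun r => by
      funext j
      simpa using he r j)
  rw [tensorNorm_apply, ← Algebra.norm_eq_of_algEquiv e', Algebra.norm_pi]
  refine Finset.prod_congr rfl fun j _ => ?_
  simp [e']

/-- The norm as a homomorphism of group schemes `Res_{L/K} G_m → G_m`. -/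
noncomputable def normHom (K L : Type u) [Field K] [Field L] [Algebra K L]
    [FiniteDimensional K L] : (ResGm K L).Hom (Gm K) where
  app R := CommGrpCat.ofHom (Units.map (tensorNorm K L R))
  naturality R S φ := by
    apply CommGrpCat.hom_ext
    apply MonoidHom.ext
    intro x
    exact Units.ext (tensorNorm_map φ.hom x.1)

end Norm

/-! ### The morphism corresponding to the sum of the cosets -/

section Correspondence

variable {K E : Type u} [Field K] [Field E] [Algebra K E]

/-- A ring homomorphism from a `K`-algebra to an `E`-algebra which respects `K → E`, as a
homomorphism of `K`-algebras. -/
def toRestrict {R : CommAlgCat.{u} K} {S : CommAlgCat.{u} E} (f : R →+* S)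
    (hf : ∀ a, f (algebraMap K R a) = algebraMap E S (algebraMap K E a)) :
    R ⟶ (restrict (algebraMap K E)).obj S :=
  letI : Algebra K S := Algebra.compHom S (algebraMap K E)
  CommAlgCat.ofHom { f with commutes' := hf }

variable [FiniteDimensional K E]

theorem sumCosets_coeff (K' : IntermediateField K E) (n : ℤ)
    (ω : Gal(E/K) ⧸ K'.fixingSubgroup) : (sumCosets K' n).coeff ω = n := by
  classical
  have := Fintype.ofFinite (Gal(E/K) ⧸ K'.fixingSubgroup)
  change (n • ∑ᶠ ω : Gal(E/K) ⧸ K'.fixingSubgroup, MonoidAlgebra.single ω (1 : ℤ)).coeff ω = n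
  rw [finsum_eq_sum_of_fintype]
  simp [Finsupp.single_apply]

/-- Both sides of the correspondence at `n` are the `n`-th powers of their values at `1`, so the
single identity for `n = 1` is equivalent to all of them. -/
theorem correspondsTo_sumCosets_iff (K' : IntermediateField K E)
    [Fintype (Gal(E/K) ⧸ K'.fixingSubgroup)] (N : (ResGm K K').Hom (Gm K)) :
    CorrespondsTo N (sumCosets K') ↔ ∀ (R : CommAlgCat.{u} E)
      (z : (K' ⊗[K] ((restrict (algebraMap K E)).obj R))ˣ),
      ((N.app ((restrict (algebraMap K E)).obj R)).hom z : Rˣ) =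
        ∏ ω, (embChar (cosetEmb K' ω)).eval R z := by
  have h1 : ∀ (n : ℤ) (R : CommAlgCat.{u} E)
      (z : (K' ⊗[K] ((restrict (algebraMap K E)).obj R))ˣ),
      (CharGroup.pullback N (gmCharMap K E n).toMul).eval R z =
        ((N.app ((restrict (algebraMap K E)).obj R)).hom z : Rˣ) ^ n := by
    intro n R z
    rw [gmCharMap_apply]
    exact zpow_eval (idChar K E) n R _
  have h2 : ∀ (n : ℤ) (R : CommAlgCat.{u} E)
      (z : (K' ⊗[K] ((restrict (algebraMap K E)).obj R))ˣ),
      (resCharMap K' (sumCosets K' n)).toMul.eval R z =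
        (∏ ω, (embChar (cosetEmb K' ω)).eval R z) ^ n := by
    intro n R z
    refine (resCharMap_eval K' _ R z).trans ?_
    rw [← Finset.prod_zpow]
    exact Finset.prod_congr rfl fun ω _ => congrArg _ (sumCosets_coeff K' n ω)
  constructor
  · intro h R z
    have := congrArg (fun χ => CharGroup.eval χ R z) (h 1)
    have := (h1 1 R z).symm.trans (this.trans (h2 1 R z))
    rwa [zpow_one, zpow_one] at this
  · intro h n
    apply CharGroup.ext
    intro R z
    exact (h1 n R z).trans ((congrArg (· ^ n) (h R z)).trans (h2 n R z).symm)

/-- A homomorphism `Res_{K'/K} G_m → G_m` is determined by its values on `E`-algebras. -/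
theorem hom_ext_of_restrict (K' : IntermediateField K E) {N N' : (ResGm K K').Hom (Gm K)}
    (h : ∀ (R : CommAlgCat.{u} E) (z : (ResGm K K').points.obj ((restrict (algebraMap K E)).obj R)),
      (N.app ((restrict (algebraMap K E)).obj R)).hom z =
        (N'.app ((restrict (algebraMap K E)).obj R)).hom z) : N = N' := by
  apply NatTrans.ext
  funext R
  apply CommGrpCat.hom_ext
  apply MonoidHom.ext
  intro z
  -- Base change to `E`: since `R` injects into `E ⊗[K] R`, naturality along this injection carries
  -- the equality of values back to `R`.
  let R' : CommAlgCat.{u} E := CommAlgCat.of E (E ⊗[K] R)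
  let f : R →ₐ[K] E ⊗[K] R := Algebra.TensorProduct.includeRight
  have hf : Function.Injective f :=
    Algebra.TensorProduct.includeRight_injective (algebraMap K E).injective
  let ι : R ⟶ (restrict (algebraMap K E)).obj R' := toRestrict f.toRingHom f.commutes
  have h1 := congrArg (fun f => f.hom z) (N.naturality ι)
  have h2 := congrArg (fun f => f.hom z) (N'.naturality ι)
  have h3 := h1.symm.trans ((h R' _).trans h2)
  exact Units.map_injective hf h3

variable [IsGalois K E]

/-- Over an `E`-algebra all factors of the splitting are `R` itself, whose norm over `R` is the
identity, so the norm is the product of the embedding characters. -/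
theorem normHom_correspondsTo (K' : IntermediateField K E) :
    CorrespondsTo (normHom K K') (sumCosets K') := by
  have := Fintype.ofFinite (Gal(E/K) ⧸ K'.fixingSubgroup)
  rw [correspondsTo_sumCosets_iff]
  intro R z
  apply Units.ext
  rw [Units.coe_prod]
  refine (tensorNorm_eq_prod
    (fun _ : Gal(E/K) ⧸ K'.fixingSubgroup => (restrict (algebraMap K E)).obj R)
    (splitEquiv K' R) (fun r ω => ?_) z.1).trans ?_
  · rw [splitEquiv_apply, tensorEval_tmul, map_one, one_mul]
    rfl
  · refine Finset.prod_congr rfl fun ω _ => ?_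
    rw [Algebra.norm_self]
    rfl

theorem correspondsTo_sumCosets_iff_eq (K' : IntermediateField K E)
    (N : (ResGm K K').Hom (Gm K)) : CorrespondsTo N (sumCosets K') ↔ N = normHom K K' := by
  have := Fintype.ofFinite (Gal(E/K) ⧸ K'.fixingSubgroup)
  constructor
  · intro h
    rw [correspondsTo_sumCosets_iff] at h
    have h' := (correspondsTo_sumCosets_iff K' _).mp (normHom_correspondsTo K')
    exact hom_ext_of_restrict K' fun R z => (h R z).trans (h' R z).symm
  · rintro rfl
    exact normHom_correspondsTo K'

end Correspondence

/-! ### Integrality over a prime `v` and the trace-dual basis -/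

section FinitePlaces

variable {K L : Type u} [Field K] [Field L] [NumberField L] [Algebra K L]

/-- The primes of `L` over a prime `v` of `K`. -/
abbrev FinFiber (L : Type u) [Field L] [NumberField L] [Algebra K L]
    (v : HeightOneSpectrum (𝓞 K)) :=
  {w : HeightOneSpectrum (𝓞 L) // w.asIdeal.LiesOver v.asIdeal}

instance (v : HeightOneSpectrum (𝓞 K)) (w : FinFiber L v) : w.1.asIdeal.LiesOver v.asIdeal := w.2

/-- An element integral at all primes over `v` is integral over the localization at `v`: its ideal
of denominators `J` lies in no prime over `v`, so by lying-over `J ∩ 𝓞 K` is not contained in `v`.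
-/
theorem exists_notMem_mul_eq_of_forall_valuation_le_one (v : HeightOneSpectrum (𝓞 K)) {t : L}
    (ht : ∀ w : FinFiber L v, w.1.valuation L t ≤ 1) :
    ∃ s : 𝓞 K, s ∉ v.asIdeal ∧ ∃ m : 𝓞 L, algebraMap K L s * t = m := by
  let J : Ideal (𝓞 L) := Submodule.comap (LinearMap.toSpanSingleton (𝓞 L) L t)
    (LinearMap.range (Algebra.linearMap (𝓞 L) L))
  have hJ : ∀ x : 𝓞 L, x ∈ J ↔ ∃ m : 𝓞 L, (m : L) = x * t := by
    intro x
    simp [J, Algebra.smul_def]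
  by_contra! hcon
  have hle : J.comap (algebraMap (𝓞 K) (𝓞 L)) ≤ v.asIdeal := by
    intro s hs
    by_contra hsv
    obtain ⟨m, hm⟩ := (hJ _).mp hs
    exact hcon s hsv m hm.symm
  obtain ⟨Q, hJQ, hQ, hQv⟩ := Ideal.exists_ideal_over_prime_of_isIntegral v.asIdeal J hle
  have hQ0 : Q ≠ ⊥ := by
    rintro rfl
    apply v.ne_bot
    rw [← hQv]
    exact Ideal.comap_bot_of_injective _ (FaithfulSMul.algebraMap_injective (𝓞 K) (𝓞 L))
  let w : FinFiber L v := ⟨⟨Q, hQ, hQ0⟩, ⟨hQv.symm⟩⟩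
  -- Integrality of `t` at `Q` supplies a denominator outside `Q`. It belongs to `J`, which is
  -- contained in `Q`: a contradiction.
  obtain ⟨n, d, hnd⟩ := HeightOneSpectrum.exists_primeCompl_mul_eq_of_integer w.1 t (ht w)
  exact d.2 (hJQ ((hJ _).mpr ⟨n, by rw [mul_comm]; exact hnd.symm⟩))

variable [NumberField K]

instance (v : HeightOneSpectrum (𝓞 K)) : Finite (FinFiber L v) := finite_fiber K L v

/-- Multiplying by a denominator `s` that is a unit at `v` makes the element integral; the trace of
an integral element is integral, and `s` does not affect the valuation. -/
theorem valuation_trace_le_one (v : HeightOneSpectrum (𝓞 K)) {t : L}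
    (ht : ∀ w : FinFiber L v, w.1.valuation L t ≤ 1) :
    v.valuation K (Algebra.trace K L t) ≤ 1 := by
  obtain ⟨s, hs, m, hm⟩ := exists_notMem_mul_eq_of_forall_valuation_le_one v ht
  have h1 : IsIntegral (𝓞 K) (Algebra.trace K L (m : L)) :=
    Algebra.isIntegral_trace (m.isIntegral_coe.tower_top)
  obtain ⟨r, hr⟩ := IsIntegrallyClosed.isIntegral_iff.mp h1
  have h2 : (s : K) * Algebra.trace K L t = r := by
    rw [← smul_eq_mul, ← map_smul, Algebra.smul_def, hm]
    exact hr.symm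
  have h3 : v.valuation K (s : K) = 1 := (v.valuation_eq_one_iff_notMem).mpr hs
  have h4 := congrArg (v.valuation K) h2
  rw [map_mul, h3, one_mul] at h4
  rw [h4]
  exact v.valuation_le_one r

/-- A common denominator of the dual basis bounds the coordinates of the elements that are
integral at the places over `v`. -/
theorem valuation_mul_coord_le_one {ι : Type*} [Fintype ι] [DecidableEq ι]
    (b : Module.Basis ι K L) {c : 𝓞 K} (hc : ∀ i, IsIntegral (𝓞 K) (c • b.traceDual i))
    (v : HeightOneSpectrum (𝓞 K)) (x : ι → K)
    (hx : ∀ w : FinFiber L v, w.1.valuation L (∑ i, algebraMap K L (x i) * b i) ≤ 1) (i : ι) :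
    v.valuation K (c * x i) ≤ 1 := by
  set t := ∑ i, algebraMap K L (x i) * b i with ht
  -- Trace against the dual basis vector extracts the `i`-th coordinate.
  have h1 : Algebra.trace K L (t * b.traceDual i) = x i := by
    rw [ht, Finset.sum_mul, map_sum, Finset.sum_eq_single i]
    · rw [mul_assoc, ← Algebra.smul_def, map_smul, b.trace_mul_traceDual]
      simp
    · intro j _ hj
      rw [mul_assoc, ← Algebra.smul_def, map_smul, b.trace_mul_traceDual]
      simp [hj]
    · simp
  have h2 : (c : K) * x i = Algebra.trace K L (t * (c • b.traceDual i)) := by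
    rw [← h1, mul_smul_comm, ← smul_eq_mul, ← map_smul]
    rfl
  rw [h2]
  refine valuation_trace_le_one v fun w => ?_
  rw [map_mul]
  refine mul_le_one' (hx w) ?_
  obtain ⟨r, hr⟩ := IsIntegrallyClosed.isIntegral_iff.mp ((hc i).tower_top (A := 𝓞 L))
  rw [← hr]
  exact w.1.valuation_le_one r

theorem exists_integral_traceDual {ι : Type*} [Fintype ι] [DecidableEq ι]
    (b : Module.Basis ι K L) :
    ∃ c : 𝓞 K, c ≠ 0 ∧ ∀ i, IsIntegral (𝓞 K) (c • b.traceDual i) := by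
  classical
  obtain ⟨c, hc, h⟩ := exists_integral_multiples (𝓞 K) K (L := L) (Finset.univ.image b.traceDual)
  exact ⟨c, hc, fun i => h _ (Finset.mem_image_of_mem _ (Finset.mem_univ i))⟩

end FinitePlaces

/-! ### Weak approximation at finitely many primes -/

section Approximation

open scoped Valued in
theorem _root_.NumberField.exists_setOf_valued_sub_le_subset {K : Type*} [Field K] [NumberField K]
    (v : HeightOneSpectrum (𝓞 K)) {x : v.adicCompletion K} {s : Set (v.adicCompletion K)}
    (hs : s ∈ nhds x) : ∃ n : ℕ, {y | Valued.v (y - x) ≤ WithZero.exp (-(n : ℤ))} ⊆ s := by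
  obtain ⟨γ, hγ⟩ := Valued.mem_nhds.mp hs
  obtain ⟨π, hπ⟩ := v.valuedAdicCompletion_surjective K (WithZero.exp (-1))
  have h1 : ‖π‖ < 1 := by
    rw [Valued.toNormedField.norm_lt_one_iff, hπ]
    exact WithZero.exp_lt_exp.mpr (by norm_num)
  obtain ⟨n, hn⟩ := ((tendsto_pow_atTop_nhds_zero_of_norm_lt_one h1).eventually
    (Valued.mem_nhds_zero.mpr ⟨γ, subset_rfl⟩)).exists
  refine ⟨n, fun y hy => hγ (lt_of_le_of_lt ?_ hn)⟩
  rw [Valuation.restrict_le_iff, map_pow, hπ, ← WithZero.exp_nsmul]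
  simpa using hy

/-- Weak approximation: a number field is dense in a finite product of its completions at primes. -/
theorem _root_.NumberField.denseRange_pi_adicCompletion {K : Type*} [Field K] [NumberField K]
    {J : Type*} [Finite J] (W : J → HeightOneSpectrum (𝓞 K)) (hW : Function.Injective W) :
    DenseRange fun (l : K) (j : J) => (l : (W j).adicCompletion K) := by
  classical
  have := Fintype.ofFinite J
  rw [denseRange_iff_closure_range, Set.eq_univ_iff_forall]
  intro y
  rw [mem_closure_iff_nhds]
  intro t ht
  rw [nhds_pi, Filter.mem_pi] at ht
  obtain ⟨I, -, s, hs, hst⟩ := ht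
  -- Each component is first approximated separately by some `l j` in `K`; what remains is to
  -- approximate the elements `l j` simultaneously.
  have hl : ∀ j, ∃ l : K, ((l : (W j).adicCompletion K)) ∈ interior (s j) := fun j =>
    ((W j).denseRange_algebraMap K).exists_mem_open isOpen_interior
      ⟨y j, mem_interior_iff_mem_nhds.mpr (hs j)⟩
  choose l hl using hl
  choose n hn using fun j =>
    NumberField.exists_setOf_valued_sub_le_subset (W j) (mem_interior_iff_mem_nhds.mp (hl j))
  obtain ⟨⟨d, hd⟩, hdl⟩ :=
    IsLocalization.exist_integer_multiples_of_finite (nonZeroDivisors (𝓞 K)) l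
  have hd0 : d ≠ 0 := nonZeroDivisors.ne_zero hd
  choose r hr using hdl
  -- The Chinese remainder theorem applies only to the numerators `r j = d * l j`. The extra
  -- exponent `m j` absorbs the loss of precision on dividing by the common denominator `d`.
  have hm : ∀ j, ∃ m : ℕ, WithZero.exp (-(m : ℤ)) ≤ (W j).valuation K (d : K) := by
    intro j
    rw [(W j).valuation_of_algebraMap, (W j).intValuation_if_neg hd0]
    exact ⟨_, le_rfl⟩
  choose m hm using hm
  obtain ⟨a, ha⟩ := IsDedekindDomain.exists_forall_sub_mem_ideal (s := Finset.univ)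
    (fun j => (W j).asIdeal) (fun j => n j + m j) (fun j _ => (W j).prime)
    (fun i _ j _ hij h => hij (hW (HeightOneSpectrum.ext h))) (fun j => r j)
  refine ⟨_, hst fun j _ => hn j ?_, ⟨(a : K) / d, rfl⟩⟩
  have hdK : (d : K) ≠ 0 := by simpa using hd0
  have h1 : ((W j).valuation K (a / d - l j)) * (W j).valuation K (d : K) ≤
      WithZero.exp (-(n j : ℤ)) * (W j).valuation K (d : K) := by
    have h2 : ((a : K) / d - l j) * d = algebraMap (𝓞 K) K (a - r j) := by
      have h3 : algebraMap (𝓞 K) K (r j) = d * l j := (hr j).trans (Algebra.smul_def d (l j))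
      rw [map_sub, h3]
      field_simp
    rw [← map_mul, h2, (W j).valuation_of_algebraMap]
    refine (((W j).intValuation_le_pow_iff_mem _ _).mpr (ha j (Finset.mem_univ j))).trans ?_
    refine le_trans (le_of_eq ?_) (mul_le_mul_right (hm j) _)
    rw [← WithZero.exp_add]
    congr 1
    push_cast
    ring
  have h2 := le_of_mul_le_mul_right h1
    (zero_lt_iff.mpr (((W j).valuation K).ne_zero_iff.mpr hdK))
  have h3 : (((a / d : K) : (W j).adicCompletion K) - (l j : K)) = ((a / d - l j : K) :) :=
    (map_sub (algebraMap K ((W j).adicCompletion K)) _ _).symm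
  change Valued.v (((a / d : K) : (W j).adicCompletion K) - (l j : K)) ≤ _
  rw [h3, HeightOneSpectrum.valuedAdicCompletion_eq_valuation']
  exact h2

end Approximation

/-! ### Coordinates on the completions over a prime -/

section FiniteCompletions

variable {K L : Type u} [Field K] [NumberField K] [Field L] [NumberField L] [Algebra K L]
  (v : HeightOneSpectrum (𝓞 K))

noncomputable instance (w : FinFiber L v) : Algebra (v.adicCompletion K) (w.1.adicCompletion L) :=
  (finCompletionMap v w.1).toAlgebra

instance (w : FinFiber L v) : ContinuousSMul (v.adicCompletion K) (w.1.adicCompletion L) :=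
  ⟨((continuous_finCompletionMap v w.1).comp continuous_fst).mul continuous_snd⟩

instance (w : FinFiber L v) : IsScalarTower K (v.adicCompletion K) (w.1.adicCompletion L) :=
  .of_algebraMap_eq fun x => (finCompletionMap_coe v w.1 x).symm

instance (w : FinFiber L v) : Module.Finite (v.adicCompletion K) (w.1.adicCompletion L) :=
  inferInstance

theorem algebraMap_fin_eq (w : FinFiber L v) (x : v.adicCompletion K) :
    algebraMap (v.adicCompletion K) (w.1.adicCompletion L) x = finCompletionMap v w.1 x := rfl

variable {ι : Type*} [Fintype ι] (b : Module.Basis ι K L)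

/-- The map `K_v^n → ∏ L_w` given by a basis of `L` over `K`. -/
noncomputable def finCoordMap :
    (ι → v.adicCompletion K) →ₗ[v.adicCompletion K] (∀ w : FinFiber L v, w.1.adicCompletion L) :=
  Fintype.linearCombination (v.adicCompletion K)
    (fun i (w : FinFiber L v) => ((b i : L) : w.1.adicCompletion L))

theorem finCoordMap_apply (x : ι → v.adicCompletion K) (w : FinFiber L v) :
    finCoordMap v b x w = ∑ i, finCompletionMap v w.1 (x i) * ((b i : L) : w.1.adicCompletion L) := by
  simp [finCoordMap, Fintype.linearCombination_apply, Finset.sum_apply, Algebra.smul_def,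
    algebraMap_fin_eq]

theorem finCoordMap_coe (x : ι → K) (w : FinFiber L v) :
    finCoordMap v b (fun i => ((x i : K) : v.adicCompletion K)) w =
      ((∑ i, algebraMap K L (x i) * b i : L) : w.1.adicCompletion L) := by
  rw [finCoordMap_apply]
  refine Eq.trans ?_ (map_sum (algebraMap L (w.1.adicCompletion L)) _ _).symm
  refine Finset.sum_congr rfl fun i _ => ?_
  rw [map_mul, finCompletionMap_coe]
  rfl

theorem continuous_finCoordMap : Continuous (finCoordMap v b) := by
  refine continuous_pi fun w => ?_
  simp only [finCoordMap_apply]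
  exact continuous_finsetSum _ fun i _ =>
    ((continuous_finCompletionMap v w.1).comp (continuous_apply i)).mul continuous_const

/-- If `finCoordMap v b x` is integral at the places over `v`, so are the coordinates of `x`, up to
a factor that does not depend on `v`. -/
theorem mul_coord_mem_integers [DecidableEq ι] {c : 𝓞 K}
    (hc : ∀ i, IsIntegral (𝓞 K) (c • b.traceDual i)) (x : ι → v.adicCompletion K)
    (hx : ∀ w : FinFiber L v, finCoordMap v b x w ∈ w.1.adicCompletionIntegers L) (i : ι) :
    ((c : K) : v.adicCompletion K) * x i ∈ v.adicCompletionIntegers K := by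
  let U : Set (ι → v.adicCompletion K) :=
    ⋂ w : FinFiber L v, {x | finCoordMap v b x w ∈ w.1.adicCompletionIntegers L}
  have hU : IsOpen U := isOpen_iInter_of_finite fun w =>
    (Valued.isOpen_valuationSubring _).preimage
      ((continuous_apply w).comp (continuous_finCoordMap v b))
  let C : Set (ι → v.adicCompletion K) :=
    {x | ((c : K) : v.adicCompletion K) * x i ∈ v.adicCompletionIntegers K}
  have hC : IsClosed C := (Valued.isClosed_valuationSubring _).preimage
    (continuous_const.mul (continuous_apply i))
  -- `U` is open and `C` closed, so `Uᶜ ∪ C` is closed. Hence the inclusion of `U` in `C` need only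
  -- be checked on the dense set of `K`-rational vectors, where it is the trace estimate.
  have hd : DenseRange fun (x : ι → K) (i : ι) => ((x i : K) : v.adicCompletion K) :=
    DenseRange.piMap fun _ => v.denseRange_algebraMap K
  have h : x ∈ Uᶜ ∪ C := by
    refine hd.induction_on (p := fun x => x ∈ Uᶜ ∪ C) x (hU.isClosed_compl.union hC) ?_
    intro y
    by_cases hy : ∀ w : FinFiber L v, w.1.valuation L (∑ i, algebraMap K L (y i) * b i) ≤ 1
    · right
      have := valuation_mul_coord_le_one b hc v y hy i
      rw [← HeightOneSpectrum.valuedAdicCompletion_eq_valuation',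
        HeightOneSpectrum.adicCompletion.coe_mul] at this
      exact this
    · left
      intro hyU
      refine hy fun w => ?_
      have := Set.mem_iInter.mp hyU w
      rw [Set.mem_ofPred_eq, finCoordMap_coe, HeightOneSpectrum.mem_adicCompletionIntegers,
        HeightOneSpectrum.valuedAdicCompletion_eq_valuation'] at this
      exact this
  rcases h with h | h
  · exact absurd (show x ∈ U from Set.mem_iInter.mpr hx) h
  · exact h

/-- The kernel is a subspace, yet by `mul_coord_mem_integers` its vectors have bounded coordinates;
scaling a nonzero one contradicts the bound. -/
theorem finCoordMap_injective : Function.Injective (finCoordMap v b) := by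
  classical
  obtain ⟨c, hc0, hc⟩ := exists_integral_traceDual b
  rw [injective_iff_map_eq_zero]
  intro x hx
  by_contra hne
  obtain ⟨i, hi⟩ := Function.ne_iff.mp hne
  have hcK : ((c : K) : v.adicCompletion K) ≠ 0 := by
    have : (algebraMap K (v.adicCompletion K) c) ≠ 0 := by simpa using hc0
    exact this
  -- Here `π` has valuation greater than `1`, so it is not integral. The kernel vector is rescaled
  -- so that `c` times its `i`-th coordinate is exactly `π`.
  obtain ⟨π, hπ⟩ := v.valuedAdicCompletion_surjective K (WithZero.exp 1)
  have h := mul_coord_mem_integers v b hc ((π * (((c : K) : v.adicCompletion K) * x i)⁻¹) • x)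
    (fun w => by rw [map_smul, hx, smul_zero]; exact zero_mem _) i
  have h2 : ((c : K) : v.adicCompletion K) *
      ((π * (((c : K) : v.adicCompletion K) * x i)⁻¹) • x) i = π := by
    have hi' : x i ≠ 0 := hi
    rw [Pi.smul_apply, smul_eq_mul]
    field_simp
  rw [h2, HeightOneSpectrum.mem_adicCompletionIntegers, hπ] at h
  exact absurd h (not_le.mpr (WithZero.exp_lt_exp.mpr (by norm_num) :
    (WithZero.exp (0:ℤ)) < WithZero.exp 1))

-- The range contains the diagonal image of `L`, which is dense by weak approximation, and it is
-- closed as a finite-dimensional subspace.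
open scoped Valued in
theorem finCoordMap_surjective : Function.Surjective (finCoordMap v b) := by
  have hd : DenseRange (finCoordMap v b) := by
    refine (NumberField.denseRange_pi_adicCompletion (fun w : FinFiber L v => w.1)
      Subtype.val_injective).mono ?_
    rintro _ ⟨l, rfl⟩
    refine ⟨fun i => ((b.repr l i : K) : v.adicCompletion K), ?_⟩
    funext w
    rw [finCoordMap_coe]
    simp only [← Algebra.smul_def, b.sum_repr]
  rw [← Set.range_eq_univ, ← LinearMap.coe_range,
    ← (LinearMap.range (finCoordMap v b)).closed_of_finiteDimensional.closure_eq]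
  exact hd.closure_range

end FiniteCompletions

/-! ### Coordinates on the completions over an infinite place -/

section InfiniteCompletions

variable {K L : Type u} [Field K] [Field L] [Algebra K L] (v : InfinitePlace K)

/-- The infinite places of `L` over an infinite place `v` of `K`. -/
abbrev InfFiber {K : Type u} [Field K] (L : Type u) [Field L] [Algebra K L]
    (v : InfinitePlace K) :=
  {w : InfinitePlace L // w.LiesOver v}

instance (w : InfFiber L v) : w.1.LiesOver v := w.2

noncomputable instance (w : InfFiber L v) : Algebra v.Completion w.1.Completion :=
  (NumberField.LiesOver.completionMap (v := v) (w := w.1)).toAlgebra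

instance (w : InfFiber L v) : ContinuousSMul v.Completion w.1.Completion :=
  ⟨(NumberField.LiesOver.continuous_completionMap.comp continuous_fst).mul continuous_snd⟩

open scoped NumberField.LiesOver in
instance (w : InfFiber L v) : Module.Finite v.Completion w.1.Completion :=
  Module.finite_of_finrank_pos <| by
    rcases w.1.isUnramified_or_isRamified K with h | h
    · rw [h.finrank_eq_one v]
      exact one_pos
    · rw [h.finrank_eq_two v]
      exact two_pos

variable {ι : Type*} [Fintype ι] (b : Module.Basis ι K L)

/-- The map `K_v^n → ∏ L_w` given by a basis of `L` over `K`. -/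
noncomputable def infCoordMap :
    (ι → v.Completion) →ₗ[v.Completion] (∀ w : InfFiber L v, w.1.Completion) :=
  Fintype.linearCombination v.Completion
    (fun i (w : InfFiber L v) => algebraMap L w.1.Completion (b i))

theorem infCoordMap_apply (x : ι → v.Completion) (w : InfFiber L v) :
    infCoordMap v b x w =
      ∑ i, NumberField.LiesOver.completionMap (x i) * algebraMap L w.1.Completion (b i) := by
  simp only [infCoordMap, Fintype.linearCombination_apply, Finset.sum_apply,
    Algebra.smul_def]
  rfl

theorem completionMap_algebraMap (w : InfFiber L v) (x : K) :
    NumberField.LiesOver.completionMap (algebraMap K v.Completion x) =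
      algebraMap L w.1.Completion (algebraMap K L x) :=
  NumberField.LiesOver.completionMap_coe ((WithAbs.equiv v.1).symm x)

theorem infCoordMap_coe (x : ι → K) (w : InfFiber L v) :
    infCoordMap v b (fun i => algebraMap K v.Completion (x i)) w =
      algebraMap L w.1.Completion (∑ i, algebraMap K L (x i) * b i) := by
  rw [infCoordMap_apply, map_sum]
  refine Finset.sum_congr rfl fun i _ => ?_
  rw [map_mul, completionMap_algebraMap]

variable [NumberField L]

theorem infCoordMap_surjective : Function.Surjective (infCoordMap (L := L) v b) := by
  -- Closedness of finite-dimensional subspaces requires an element of norm greater than `1`; the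
  -- element `2` serves.
  let : NontriviallyNormedField v.Completion :=
    { (inferInstance : NormedField v.Completion) with
      non_trivial := ⟨algebraMap K v.Completion 2, by
        have : ‖algebraMap K v.Completion 2‖ = v 2 :=
          InfinitePlace.Completion.norm_coe v ((WithAbs.equiv v.1).symm 2)
        rw [this, ← InfinitePlace.norm_embedding_eq, map_ofNat]
        norm_num⟩ }
  have hd : DenseRange (infCoordMap (L := L) v b) := by
    have h1 : DenseRange fun (l : L) (w : InfFiber L v) => algebraMap L w.1.Completion l := by
      -- Density over the fibre of `v` follows from density of `L` in the infinite adeles by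
      -- projecting to the places over `v`.
      let f : InfiniteAdeleRing L → (∀ w : InfFiber L v, w.1.Completion) := fun y w => y w.1
      have hf : Continuous f := continuous_pi fun w => continuous_apply w.1
      have hs : Function.Surjective f := by
        classical
        intro y
        refine ⟨fun w => if h : w.LiesOver v then y ⟨w, h⟩ else 0, ?_⟩
        funext w
        exact dif_pos w.2
      exact hs.denseRange.comp (InfiniteAdeleRing.denseRange_algebraMap L) hf
    refine h1.mono ?_
    rintro _ ⟨l, rfl⟩
    refine ⟨fun i => algebraMap K v.Completion (b.repr l i), ?_⟩
    funext w
    rw [infCoordMap_coe]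
    simp only [← Algebra.smul_def, b.sum_repr]
  rw [← Set.range_eq_univ, ← LinearMap.coe_range,
    ← (LinearMap.range (infCoordMap (L := L) v b)).closed_of_finiteDimensional.closure_eq]
  exact hd.closure_range

variable [NumberField K]

open scoped Classical NumberField.LiesOver in
theorem sum_finrank_infFiber :
    ∑ w : InfFiber L v, Module.finrank v.Completion w.1.Completion = Module.finrank K L := by
  rw [← v.sum_inertiaDeg_eq_finrank K L]
  refine (Finset.sum_congr rfl fun w _ => (v.inertiaDeg_eq_finrank w.1).symm).trans ?_
  refine (Finset.sum_subtype _ (fun w => ?_) _).symm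
  exact Set.mem_toFinset

/-- A surjection between spaces of equal dimension is injective; the dimensions agree because the
local degrees over `v` add up to `[L : K]`. -/
theorem infCoordMap_injective : Function.Injective (infCoordMap (L := L) v b) := by
  classical
  rw [LinearMap.injective_iff_surjective_of_finrank_eq_finrank]
  · exact infCoordMap_surjective v b
  · rw [Module.finrank_pi, Module.finrank_pi_fintype, sum_finrank_infFiber,
      Module.finrank_eq_card_basis b]

end InfiniteCompletions

/-! ### A coordinate criterion for isomorphisms out of `L ⊗[K] R` -/

section TensorLift

variable {K L R S : Type u} [Field K] [Field L] [Algebra K L] [CommRing R] [Algebra K R]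
  [CommRing S]

/-- The homomorphism `L ⊗[K] R → S`, `l ⊗ r ↦ g(l) f(r)`. -/
noncomputable def tensorLift (g : L →+* S) (f : R →+* S)
    (h : ∀ x, f (algebraMap K R x) = g (algebraMap K L x)) : L ⊗[K] R →+* S :=
  letI : Algebra K S := (g.comp (algebraMap K L)).toAlgebra
  (Algebra.TensorProduct.lift ({ g with commutes' := fun _ => rfl } : L →ₐ[K] S)
    ({ f with commutes' := h } : R →ₐ[K] S) fun _ _ => Commute.all _ _).toRingHom

theorem tensorLift_tmul (g : L →+* S) (f : R →+* S)
    (h : ∀ x, f (algebraMap K R x) = g (algebraMap K L x)) (l : L) (r : R) :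
    tensorLift g f h (l ⊗ₜ r) = g l * f r := rfl

theorem tensorLift_bijective {ι : Type*} [Fintype ι] (b : Module.Basis ι K L) (g : L →+* S)
    (f : R →+* S) (h : ∀ x, f (algebraMap K R x) = g (algebraMap K L x))
    (hb : Function.Bijective fun x : ι → R => ∑ i, f (x i) * g (b i)) :
    Function.Bijective (tensorLift g f h) := by
  classical
  have : (fun x : ι → R => ∑ i, f (x i) * g (b i)) =
      tensorLift g f h ∘ (tensorCoord b R).symm := by
    funext x
    rw [Function.comp_apply, tensorCoord_symm_apply, map_sum]
    exact Finset.sum_congr rfl fun i _ => (mul_comm _ _).trans (tensorLift_tmul g f h _ _).symm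
  rw [this] at hb
  exact (Function.Bijective.of_comp_iff _ (tensorCoord b R).symm.bijective).mp hb

end TensorLift

/-! ### Local splittings and the product of local norms -/

section LocalSplitting

variable {K L : Type u} [Field K] [NumberField K] [Field L] [NumberField L] [Algebra K L]

/-- The isomorphism `L ⊗[K] K_v ≃ ∏ L_w` at a prime `v`. -/
noncomputable def finSplit (L : Type u) [Field L] [NumberField L] [Algebra K L]
    (v : HeightOneSpectrum (𝓞 K)) :
    L ⊗[K] v.adicCompletion K ≃+* (∀ w : FinFiber L v, w.1.adicCompletion L) :=
  RingEquiv.ofBijective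
    (tensorLift (RingHom.pi fun w : FinFiber L v => algebraMap L (w.1.adicCompletion L))
      (RingHom.pi fun w : FinFiber L v => finCompletionMap v w.1)
      (fun x => funext fun w => finCompletionMap_coe v w.1 x)) <| by
    refine tensorLift_bijective (Module.finBasis K L) _ _ _ ?_
    have h : (finCoordMap (L := L) v (Module.finBasis K L) : _ → _) = fun x => ∑ i,
        (RingHom.pi fun w : FinFiber L v => finCompletionMap v w.1) (x i) *
        (RingHom.pi fun w : FinFiber L v => algebraMap L (w.1.adicCompletion L))
          (Module.finBasis K L i) := by
      funext x w
      rw [finCoordMap_apply, Finset.sum_apply]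
      rfl
    rw [← h]
    exact ⟨finCoordMap_injective v _, finCoordMap_surjective v _⟩

theorem finSplit_tmul (v : HeightOneSpectrum (𝓞 K)) (l : L) (x : v.adicCompletion K)
    (w : FinFiber L v) :
    finSplit L v (l ⊗ₜ x) w = (l : w.1.adicCompletion L) * finCompletionMap v w.1 x := rfl

/-- The isomorphism `L ⊗[K] K_v ≃ ∏ L_w` at an infinite place `v`. -/
noncomputable def infSplit (L : Type u) [Field L] [NumberField L] [Algebra K L]
    (v : InfinitePlace K) :
    L ⊗[K] v.Completion ≃+* (∀ w : InfFiber L v, w.1.Completion) :=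
  RingEquiv.ofBijective
    (tensorLift (RingHom.pi fun w : InfFiber L v => algebraMap L w.1.Completion)
      (RingHom.pi fun w : InfFiber L v => NumberField.LiesOver.completionMap)
      (fun x => funext fun w => completionMap_algebraMap v w x)) <| by
    refine tensorLift_bijective (Module.finBasis K L) _ _ _ ?_
    have h : (infCoordMap (L := L) v (Module.finBasis K L) : _ → _) = fun x => ∑ i,
        (RingHom.pi fun w : InfFiber L v => NumberField.LiesOver.completionMap) (x i) *
        (RingHom.pi fun w : InfFiber L v => algebraMap L w.1.Completion)
          (Module.finBasis K L i) := by
      funext x w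
      rw [infCoordMap_apply, Finset.sum_apply]
      rfl
    rw [← h]
    exact ⟨infCoordMap_injective v _, infCoordMap_surjective v _⟩

theorem infSplit_tmul (v : InfinitePlace K) (l : L) (x : v.Completion) (w : InfFiber L v) :
    infSplit L v (l ⊗ₜ x) w =
      algebraMap L w.1.Completion l * NumberField.LiesOver.completionMap x := rfl

theorem tensorNorm_fin (v : HeightOneSpectrum (𝓞 K)) (z : L ⊗[K] v.adicCompletion K) :
    tensorNorm K L _ z = ∏ᶠ w : FinFiber L v, finLocalNorm v w.1 (finSplit L v z w) := by
  have := Fintype.ofFinite (FinFiber L v)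
  rw [finprod_eq_prod_of_fintype]
  exact tensorNorm_eq_prod (fun w : FinFiber L v => w.1.adicCompletion L) (finSplit L v)
    (fun r w => (finSplit_tmul v 1 r w).trans
      ((congrArg (· * _) (map_one (algebraMap L (w.1.adicCompletion L)))).trans (one_mul _))) z

theorem tensorNorm_inf (v : InfinitePlace K) (z : L ⊗[K] v.Completion) :
    tensorNorm K L _ z = ∏ᶠ w : InfFiber L v, infLocalNorm v w.1 (infSplit L v z w) := by
  have := Fintype.ofFinite (InfFiber L v)
  rw [finprod_eq_prod_of_fintype]
  exact tensorNorm_eq_prod (fun w : InfFiber L v => w.1.Completion) (infSplit L v)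
    (fun r w => (infSplit_tmul v 1 r w).trans
      ((congrArg (· * _) (map_one (algebraMap L w.1.Completion))).trans (one_mul _))) z

end LocalSplitting

/-! ### The adeles of `L` as a base change, and the idele norm -/

section AdeleSplitting

variable {K L : Type u} [Field K] [NumberField K] [Field L] [NumberField L] [Algebra K L]

/-- The component of an adele at a prime. -/
noncomputable def adeleFin (v : HeightOneSpectrum (𝓞 K)) :
    AdeleRing (𝓞 K) K →ₐ[K] v.adicCompletion K where
  toFun a := a.2 v
  map_one' := rfl
  map_mul' _ _ := rfl
  map_zero' := rfl
  map_add' _ _ := rfl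
  commutes' _ := rfl

/-- The component of an adele at an infinite place. -/
noncomputable def adeleInf (v : InfinitePlace K) :
    AdeleRing (𝓞 K) K →ₐ[K] v.Completion where
  toFun a := a.1 v
  map_one' := rfl
  map_mul' _ _ := rfl
  map_zero' := rfl
  map_add' _ _ := rfl
  commutes' _ := rfl

theorem adeleMap_fin (a : AdeleRing (𝓞 K) K) (v : HeightOneSpectrum (𝓞 K)) (w : FinFiber L v) :
    (adeleMap K L a).2 w.1 = finCompletionMap v w.1 (a.2 v) := by
  obtain ⟨w, hw⟩ := w
  obtain rfl : w.under (𝓞 K) = v := HeightOneSpectrum.ext hw.over.symm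
  rfl

theorem adeleMap_inf (a : AdeleRing (𝓞 K) K) (v : InfinitePlace K) (w : InfFiber L v) :
    (adeleMap K L a).1 w.1 = NumberField.LiesOver.completionMap (a.1 v) := by
  obtain ⟨w, hw⟩ := w
  obtain rfl : w.comap (algebraMap K L) = v := InfinitePlace.LiesOver.comap_eq w v
  rfl

theorem adeleBaseChange_fin (v : HeightOneSpectrum (𝓞 K)) (w : FinFiber L v)
    (z : L ⊗[K] AdeleRing (𝓞 K) K) :
    (adeleBaseChange K L z).2 w.1 =
      finSplit L v (Algebra.TensorProduct.map (AlgHom.id L L) (adeleFin v) z) w := by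
  induction z with
  | zero =>
    simp only [map_zero]
    rfl
  | add z z' hz hz' =>
    simp only [map_add, Pi.add_apply, ← hz, ← hz']
    rfl
  | tmul l a =>
    rw [adeleBaseChange_tmul, Algebra.TensorProduct.map_tmul, finSplit_tmul]
    exact congrArg (_ * ·) (adeleMap_fin a v w)

theorem adeleBaseChange_inf (v : InfinitePlace K) (w : InfFiber L v)
    (z : L ⊗[K] AdeleRing (𝓞 K) K) :
    (adeleBaseChange K L z).1 w.1 =
      infSplit L v (Algebra.TensorProduct.map (AlgHom.id L L) (adeleInf v) z) w := by
  induction z with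
  | zero =>
    simp only [map_zero]
    rfl
  | add z z' hz hz' =>
    simp only [map_add, Pi.add_apply, ← hz, ← hz']
    rfl
  | tmul l a =>
    rw [adeleBaseChange_tmul, Algebra.TensorProduct.map_tmul, infSplit_tmul]
    exact congrArg (_ * ·) (adeleMap_inf a v w)

/-- On adelic points, the norm is the idele norm. -/
theorem norm_adeleBaseChange (z : L ⊗[K] AdeleRing (𝓞 K) K) :
    tensorNorm K L _ z = (infNorm K L).prodMap (finNorm K L) (adeleBaseChange K L z) := by
  refine Prod.ext ?_ ?_
  · funext v
    -- Projecting to the component at `v` is a `K`-algebra homomorphism, so naturality of the norm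
    -- reduces the adelic identity to the local one.
    refine (tensorNorm_map (adeleInf v) z).symm.trans ((tensorNorm_inf v _).trans ?_)
    exact finprod_congr fun w => congrArg _ (adeleBaseChange_inf v w z).symm
  · apply FiniteAdeleRing.ext
    intro v
    refine (tensorNorm_map (adeleFin v) z).symm.trans ((tensorNorm_fin v _).trans ?_)
    exact finprod_congr fun w => congrArg _ (adeleBaseChange_fin v w z).symm

theorem adeleBaseChange_sum_fin {ι : Type*} [Fintype ι] (b : Module.Basis ι K L)
    (a : ι → AdeleRing (𝓞 K) K) (v : HeightOneSpectrum (𝓞 K)) (w : FinFiber L v) :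
    (adeleBaseChange K L (∑ i, b i ⊗ₜ a i)).2 w.1 = finCoordMap v b (fun i => (a i).2 v) w := by
  rw [adeleBaseChange_fin, finCoordMap_apply, map_sum, map_sum, Finset.sum_apply]
  refine Finset.sum_congr rfl fun i _ => ?_
  rw [Algebra.TensorProduct.map_tmul, finSplit_tmul, mul_comm]
  rfl

theorem adeleBaseChange_sum_inf {ι : Type*} [Fintype ι] (b : Module.Basis ι K L)
    (a : ι → AdeleRing (𝓞 K) K) (v : InfinitePlace K) (w : InfFiber L v) :
    (adeleBaseChange K L (∑ i, b i ⊗ₜ a i)).1 w.1 = infCoordMap v b (fun i => (a i).1 v) w := by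
  rw [adeleBaseChange_inf, infCoordMap_apply, map_sum, map_sum, Finset.sum_apply]
  refine Finset.sum_congr rfl fun i _ => ?_
  rw [Algebra.TensorProduct.map_tmul, infSplit_tmul, mul_comm]
  rfl

variable (K L)

theorem adeleBaseChange_injective : Function.Injective (adeleBaseChange K L) := by
  rw [injective_iff_map_eq_zero]
  intro z hz
  let b := Module.finBasis K L
  obtain ⟨a, rfl⟩ := (tensorCoord b (AdeleRing (𝓞 K) K)).symm.surjective z
  rw [tensorCoord_symm_apply] at hz
  have h : a = 0 := by
    funext i
    refine Prod.ext ?_ ?_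
    · funext v
      refine congrFun (infCoordMap_injective (L := L) v b
        (a₁ := fun i => (a i).1 v) (a₂ := 0) ?_) i
      rw [map_zero]
      funext w
      rw [← adeleBaseChange_sum_inf, hz]
      rfl
    · apply FiniteAdeleRing.ext
      intro v
      refine congrFun (finCoordMap_injective (L := L) v b
        (a₁ := fun i => (a i).2 v) (a₂ := 0) ?_) i
      rw [map_zero]
      funext w
      rw [← adeleBaseChange_sum_fin, hz]
      rfl
  rw [h, map_zero]

/-- The local coordinate equations are solved at every place separately. The point is that the
solutions form adeles, which needs the bound with `c` uniform in `v`. -/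
theorem adeleBaseChange_surjective : Function.Surjective (adeleBaseChange K L) := by
  classical
  intro y
  let b := Module.finBasis K L
  obtain ⟨c, hc0, hc⟩ := exists_integral_traceDual b
  choose x hx using fun v : InfinitePlace K =>
    infCoordMap_surjective (L := L) v b (fun w => y.1 w.1)
  choose x' hx' using fun v : HeightOneSpectrum (𝓞 K) =>
    finCoordMap_surjective (L := L) v b (fun w => y.2 w.1)
  have hfin : ∀ i, ∀ᶠ v in Filter.cofinite, x' v i ∈ v.adicCompletionIntegers K := by
    intro i
    have h1 : {w : HeightOneSpectrum (𝓞 L) | ¬ y.2 w ∈ w.adicCompletionIntegers L}.Finite := y.2.2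
    have h2 : {v : HeightOneSpectrum (𝓞 K) | 1 < v.valuation K (c : K)⁻¹}.Finite :=
      HeightOneSpectrum.Support.finite (𝓞 K) (c : K)⁻¹
    -- Exceptional primes lie under a place where `y` is not integral, or have `c⁻¹` non-integral.
    -- Elsewhere `c * x' v i` is integral and `c` can be divided out.
    refine ((h1.image (HeightOneSpectrum.under (𝓞 K))).union h2).subset ?_
    intro v hv
    by_contra hv'
    rw [Set.mem_union, not_or] at hv'
    refine hv ?_
    have h3 := mul_coord_mem_integers v b hc (x' v) (fun w => by
      rw [hx']
      by_contra hw
      exact hv'.1 ⟨w.1, hw, HeightOneSpectrum.ext w.2.over.symm⟩) i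
    have h4 : (((c : K)⁻¹ : K) : v.adicCompletion K) ∈ v.adicCompletionIntegers K := by
      rw [HeightOneSpectrum.mem_adicCompletionIntegers,
        HeightOneSpectrum.valuedAdicCompletion_eq_valuation']
      exact not_lt.mp hv'.2
    have h5 := mul_mem h4 h3
    have hcK : (c : K) ≠ 0 := by simpa using hc0
    rwa [← mul_assoc, ← HeightOneSpectrum.adicCompletion.coe_mul, inv_mul_cancel₀ hcK,
      HeightOneSpectrum.adicCompletion.coe_one, one_mul] at h5
  let a : Fin (Module.finrank K L) → AdeleRing (𝓞 K) K :=
    fun i => ((fun v => x v i : InfiniteAdeleRing K),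
      (⟨fun v => x' v i, hfin i⟩ : FiniteAdeleRing (𝓞 K) K))
  refine ⟨∑ i, b i ⊗ₜ a i, Prod.ext ?_ ?_⟩
  · funext w
    exact (adeleBaseChange_sum_inf b a _ ⟨w, comap_liesOver K L w⟩).trans
      (congrFun (hx (w.comap (algebraMap K L))) ⟨w, comap_liesOver K L w⟩)
  · apply FiniteAdeleRing.ext
    intro w
    exact (adeleBaseChange_sum_fin b a (w.under (𝓞 K)) ⟨w, ⟨rfl⟩⟩).trans
      (congrFun (hx' (w.under (𝓞 K))) ⟨w, ⟨rfl⟩⟩)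

end AdeleSplitting

end QuasiSplitTorus

theorem mainTheorem6 {K E : Type u} [Field K] [NumberField K] [Field E] [NumberField E]
    [Algebra K E] [IsGalois K E] (K' : IntermediateField K E) :
    -- the identifications of the character modules of `G_m` and of `Res_{K'/K} G_m`
    Function.Bijective (QuasiSplitTorus.gmCharMap K E) ∧
    Function.Bijective (QuasiSplitTorus.resCharMap K') ∧
    -- the identification of the adelic points of `Res_{K'/K} G_m` with the ideles
    Function.Bijective (QuasiSplitTorus.adeleBaseChange K K') ∧
    -- the morphism corresponding to `1 ↦ ∑ G/G_{K'}` exists, is unique, and is the idele norm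
    -- on adelic points
    ∃ N : (QuasiSplitTorus.ResGm K K').Hom (QuasiSplitTorus.Gm K),
      (∀ N' : (QuasiSplitTorus.ResGm K K').Hom (QuasiSplitTorus.Gm K),
        QuasiSplitTorus.CorrespondsTo N' (QuasiSplitTorus.sumCosets K') ↔ N' = N) ∧
      ∀ z : (K' ⊗[K] AdeleRing (𝓞 K) K)ˣ,
        N.onPoints (AdeleRing (𝓞 K) K) z =
          QuasiSplitTorus.ideleNorm K K'
            (Units.map (QuasiSplitTorus.adeleBaseChange K K' : _ →* _) z) :=
  ⟨QuasiSplitTorus.gmCharMap_bijective K E, QuasiSplitTorus.resCharMap_bijective K',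
    ⟨QuasiSplitTorus.adeleBaseChange_injective K K',
      QuasiSplitTorus.adeleBaseChange_surjective K K'⟩,
    QuasiSplitTorus.normHom K K', QuasiSplitTorus.correspondsTo_sumCosets_iff_eq K',
    fun z => Units.ext (QuasiSplitTorus.norm_adeleBaseChange z.1)⟩
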